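/- Let $G$ be a finite group, $R$ a commutative ring and $M:\mathcal O(G)\to R\text{-Mod}$ a covariant coefficient system, i.e. a covariant functor on the category of orbits $G/H$ ($H\subset G$ a subgroup) and $G$-functions; write $M_*(\alpha)$ for the homomorphism induced by $\alpha$. **Algebra.** For a pointed $G$-set $S$ (base point $x_0$ fixed by $G$; $G_x$ is the isotropy group of $x$) let $F(S,M)$ be the module of functions $u$ on $S$ with $u(x)\in M(G/G_x)$, $u(x_0)=0$ and $u(x)=0$ for almost every $x$. It is generated by the elements $lx$ ($x\in S$, $l\in M(G/G_x)$), where $lx$ has value $l$ at $x$ and $0$ elsewhere if $x\ne x_0$, and $lx_0=0$. A pointed $G$-function $f:S\to T$ induces $f_*(lx)=M_*(\hat f_x)(l)\,f(x)$, where $\hat f_x:G/G_x\to G/G_{f(x)}$ is the canonical projection. The group $G$ acts on $F(S,M)$ by $g\cdot(lx)=M_*(R_{g^{-1}})(l)\,(gx)$, with $R_{g^{-1}}:G/G_x\to G/G_{gx}$, $aG_x\mapsto ag^{-1}G_{gx}$. Let $\beta_S:F(S,M)\to F(S,M)^G$ be the epimorphism $\beta_S(lx)=\gamma^G_x(l)=\sum_{[g]\in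 G/G_x}M_*(R_{g^{-1}})(l)\,(gx)$. As modules $\overline F^G(S,M)=F^G(S,M)=F(S,M)^G$; the functor $\overline F^G(-,M)$ has $\overline f^G_*=f_*|_{F(S,M)^G}$, and the functor $F^G(-,M)$ has $f^G_*(\gamma^G_x(l))=\gamma^G_{f(x)}(M_*(\hat f_x)(l))$, so that $f^G_*\beta_S=\beta_T f_*$. Write $\iota_S$ for the inclusion $\overline F^G(S,M)\subset F(S,M)$. For a simplicial pointed $G$-set $Q$, applying these functors in each degree gives simplicial groups $F(Q,M)$, $\overline F^G(Q,M)$, $F^G(Q,M)$ with simplicial homomorphisms $\iota_Q$, $\beta_Q$. **Topology.** All spaces, products and topological groups are in the category of k-spaces. A simplicial set $X$ has geometric realization $|X|=\coprod_n X_n\times\Delta^n/\sim$ with points $[x,t]$; the realization of a simplicial module is an abelian group with $[a,t]+[b,t]=[a+b,t]$, and $|Q|$ is a pointed $G$-space with $g[x,t]=[gx,t]$. For a pointed $G$-space $X$, a subgroup $H\subset G$ and $L=M(G/H)$ with the discrete topology, the module $F(X^H,L)$ of functions $X^H\to L$ vanishing at the base point and almost everywhere has the identification topology of $\coprod_k(L\times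 X^H)^k\to F(X^H,L)$, $(l_1,x_1;\dots;l_k,x_k)\mapsto\sum_i l_ix_i$, where $X^H$ has the relative k-topology. Then $\mathfrak F(X,M)$ is $F(X,M)$ with the identification topology of $$p_X:\prod_{H\subset G}F(X^H,M(G/H))\to F(X,M),\qquad (l_Hx_H)_H\mapsto\sum_H M_*(q_{H,x_H})(l_H)\,x_H,$$ where $q_{H,x}:G/H\to G/G_x$ is the canonical projection. Further, $\overline{\mathfrak F}^G(X,M)$ is $\overline F^G(X,M)\subset\mathfrak F(X,M)$ with the relative k-topology, and $\mathfrak F^G(X,M)$ is $F^G(X,M)$ with the identification topology of $\beta_X:\mathfrak F(X,M)\to F^G(X,M)$. **Theorem.** For every simplicial pointed $G$-set $Q$, the groups $|F(Q,M)|$, $|\overline F^G(Q,M)|$, $|F^G(Q,M)|$, $\mathfrak F(|Q|,M)$, $\overline{\mathfrak F}^G(|Q|,M)$ and $\mathfrak F^G(|Q|,M)$ are topological groups in the category of k-spaces, and there is an isomorphism of topological groups $$\Psi_Q:|F(Q,M)|\to\mathfrak F(|Q|,M),\qquad \Psi_Q([lx,t])=M_*(q_{x,t})(l)\,[x,t],$$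 where $q_{x,t}:G/G_x\to G/G_{[x,t]}$ is the canonical projection. Moreover, there are isomorphisms of topological groups $$\overline\Psi{}^G_Q:|\overline F^G(Q,M)|\to\overline{\mathfrak F}^G(|Q|,M),\qquad \Psi^G_Q:|F^G(Q,M)|\to\mathfrak F^G(|Q|,M)$$ with $\iota_{|Q|}\circ\overline\Psi{}^G_Q=\Psi_Q\circ|\iota_Q|$ and $\Psi^G_Q\circ|\beta_Q|=\beta_{|Q|}\circ\Psi_Q$. All three isomorphisms are natural in $Q$. -/

import Mathlib

open CategoryTheory Opposite

universe u v w

namespace DoldThom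

/-! ### Simplices and geometric realization -/

/-- The standard topological simplex `Δⁿ`. -/
abbrev TopSimplex (n : SimplexCategory) : Type := stdSimplex ℝ (Fin (n.len + 1))

/-- The map `α_* : Δᵐ → Δⁿ`, affine on `Δᵐ`, given on vertices by `α`. -/
noncomputable def simplexMap {m n : SimplexCategory} (α : m ⟶ n) (t : TopSimplex m) :
    TopSimplex n :=
  stdSimplex.map α.toOrderHom t

theorem simplexMap_id {n : SimplexCategory} (t : TopSimplex n) : simplexMap (𝟙 n) t = t :=
  stdSimplex.map_id_apply t

theorem simplexMap_comp {k m n : SimplexCategory} (α : k ⟶ m) (β : m ⟶ n) (t : TopSimplex k) :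
    simplexMap (α ≫ β) t = simplexMap β (simplexMap α t) := by
  unfold simplexMap
  rw [stdSimplex.map_comp_apply]
  rfl

theorem simplexMap_apply {m n : SimplexCategory} (α : m ⟶ n) (t : TopSimplex m)
    (j : Fin (n.len + 1)) :
    simplexMap α t j = ∑ i with α.toOrderHom i = j, t i :=
  FunOnFinite.linearMap_apply_apply _ _ _ _ _

/-- The disjoint union `∐ₙ Xₙ × Δⁿ`. -/
abbrev PreRealization (X : SSet.{u}) : Type u :=
  Σ n : SimplexCategory, X.obj (op n) × TopSimplex n

/-- The relation `(α^* x, t) ∼ (x, α_* t)`. -/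
inductive RealizationRel (X : SSet.{u}) : PreRealization X → PreRealization X → Prop
  | glue {m n : SimplexCategory} (α : m ⟶ n) (x : X.obj (op n)) (t : TopSimplex m) :
      RealizationRel X ⟨m, X.map α.op x, t⟩ ⟨n, x, simplexMap α t⟩

/-- The geometric realization `|X|` of a simplicial set. -/
def Realization (X : SSet.{u}) : Type u := Quot (RealizationRel X)

namespace Realization

/-- The topology of the disjoint union of the products of the discrete sets `Xₙ` with `Δⁿ`. -/
@[reducible]
def preTopology (X : SSet.{u}) : TopologicalSpace (PreRealization X) :=
  @instTopologicalSpaceSigma _ _ (fun _ => @instTopologicalSpaceProd _ _ ⊥ inferInstance)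

/-- The identification topology. -/
instance (X : SSet.{u}) : TopologicalSpace (Realization X) :=
  (preTopology X).coinduced (Quot.mk _)

/-- The point `[x, t]` of `|X|`. -/
def mk {X : SSet.{u}} {n : SimplexCategory} (x : X.obj (op n)) (t : TopSimplex n) :
    Realization X :=
  Quot.mk _ ⟨n, x, t⟩

theorem ind {X : SSet.{u}} {P : Realization X → Prop}
    (h : ∀ (n : SimplexCategory) (x : X.obj (op n)) (t : TopSimplex n), P (mk x t))
    (p : Realization X) : P p :=
  Quot.ind (fun a => h a.1 a.2.1 a.2.2) p

theorem glue {X : SSet.{u}} {m n : SimplexCategory} (α : m ⟶ n) (x : X.obj (op n))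
    (t : TopSimplex m) : mk (X.map α.op x) t = mk x (simplexMap α t) :=
  Quot.sound (RealizationRel.glue α x t)

/-- The map `|f| : |X| → |Y|`, `[x, t] ↦ [f x, t]`. -/
def map {X Y : SSet.{u}} (f : X ⟶ Y) : Realization X → Realization Y :=
  Quot.map (fun p => ⟨p.1, f.app (op p.1) p.2.1, p.2.2⟩) (by
    rintro _ _ ⟨α, x, t⟩
    have h : f.app _ (X.map α.op x) = Y.map α.op (f.app _ x) :=
      NatTrans.naturality_apply f α.op x
    dsimp only
    rw [h]
    exact RealizationRel.glue α _ t)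

theorem map_mk {X Y : SSet.{u}} (f : X ⟶ Y) {n : SimplexCategory} (x : X.obj (op n))
    (t : TopSimplex n) : map f (mk x t) = mk (f.app (op n) x) t := rfl

theorem continuous_map {X Y : SSet.{u}} (f : X ⟶ Y) : Continuous (map f) := by
  refine continuous_coinduced_dom.2 ?_
  let _ := preTopology X
  let _ := preTopology Y
  have h : Continuous (fun p : PreRealization X =>
      (⟨p.1, f.app (op p.1) p.2.1, p.2.2⟩ : PreRealization Y)) := by
    let _ : ∀ n : SimplexCategory, TopologicalSpace (X.obj (op n)) := fun _ => ⊥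
    let _ : ∀ n : SimplexCategory, TopologicalSpace (Y.obj (op n)) := fun _ => ⊥
    have : ∀ n : SimplexCategory, DiscreteTopology (X.obj (op n)) := fun _ => ⟨rfl⟩
    refine continuous_sigma fun n => ?_
    exact (continuous_sigmaMk (σ := fun n : SimplexCategory => Y.obj (op n) × TopSimplex n)).comp
      (((continuous_of_discreteTopology (f := fun x => f.app (op n) x)).comp continuous_fst).prodMk continuous_snd)
  exact continuous_coinduced_rng.comp h

/-- `|X|` is a k-space. -/
instance (X : SSet.{u}) : UCompactlyGeneratedSpace.{u} (Realization X) := by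
  let _ := preTopology X
  have : UCompactlyGeneratedSpace.{u} (PreRealization X) := by
    let _ : ∀ n : SimplexCategory, TopologicalSpace (X.obj (op n)) := fun _ => ⊥
    have : ∀ n : SimplexCategory, DiscreteTopology (X.obj (op n)) := fun _ => ⟨rfl⟩
    have : ∀ n : SimplexCategory, SequentialSpace (X.obj (op n) × TopSimplex n) :=
      fun n => inferInstance
    exact inferInstanceAs (UCompactlyGeneratedSpace.{u}
      (Σ n : SimplexCategory, X.obj (op n) × TopSimplex n))
  exact uCompactlyGeneratedSpace_of_coinduced (f := Quot.mk (RealizationRel X))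
    continuous_coinduced_rng rfl

end Realization

/-! ### Common refinements of points of simplices -/

theorem simplexMap_injective_of_pos {k n : SimplexCategory} {u : TopSimplex k}
    (hu : ∀ i, 0 < u i) {α β : k ⟶ n} (h : simplexMap α u = simplexMap β u) : α = β := by
  have key : ∀ (α β : k ⟶ n), simplexMap α u = simplexMap β u →
      ∀ i, ¬ α.toOrderHom i < β.toOrderHom i := by
    intro α β h i hi
    have cum : ∀ γ : k ⟶ n, ∑ j with j ≤ α.toOrderHom i, simplexMap γ u j =
        ∑ i' with γ.toOrderHom i' ≤ α.toOrderHom i, u i' := by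
      intro γ
      simp_rw [simplexMap_apply]
      rw [← Finset.sum_biUnion]
      · refine Finset.sum_congr ?_ fun _ _ => rfl
        ext i'; simp
      · intro a _ b _ hab
        refine Finset.disjoint_left.2 fun c hc hc' => hab ?_
        simp only [Finset.mem_filter, Finset.mem_univ, true_and] at hc hc'
        exact hc.symm.trans hc'
    have h1 := cum α
    rw [h, cum β] at h1
    refine absurd h1 (ne_of_lt ?_)
    refine Finset.sum_lt_sum_of_subset (i := i) ?_ ?_ ?_ (hu i) fun j _ _ => (hu j).le
    · intro j hj
      simp only [Finset.mem_filter, Finset.mem_univ, true_and] at hj ⊢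
      refine α.toOrderHom.monotone (le_of_not_gt fun hij => ?_)
      exact absurd (lt_of_lt_of_le hi (β.toOrderHom.monotone hij.le)) (not_lt.2 hj)
    · simp
    · simpa using hi
  ext i : 3
  exact le_antisymm (not_lt.1 (key β α h.symm i)) (not_lt.1 (key α β h i))

/-- The partial sums of the coordinates of a point of a simplex. -/
noncomputable def cumul {m : ℕ} (s : Fin m → ℝ) (i : ℕ) : ℝ :=
  ∑ j : Fin m, if (j : ℕ) < i then s j else 0

theorem cumul_zero {m : ℕ} (s : Fin m → ℝ) : cumul s 0 = 0 := by simp [cumul]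

theorem cumul_top {m : ℕ} (s : Fin m → ℝ) : cumul s m = ∑ j, s j := by simp [cumul]

theorem cumul_succ {m : ℕ} (s : Fin m → ℝ) (i : Fin m) :
    cumul s (i + 1) = cumul s i + s i := by
  have : ∀ j : Fin m, (if (j : ℕ) < (i : ℕ) + 1 then s j else 0) =
      (if (j : ℕ) < i then s j else 0) + if j = i then s j else 0 := by
    intro j
    rcases lt_trichotomy (j : ℕ) i with h | h | h
    · have : j ≠ i := fun e => by simp [e] at h
      simp [h, this, Nat.lt_succ_of_lt h]
    · have : j = i := Fin.ext h
      simp [this]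
    · have h' : j ≠ i := fun e => by simp [e] at h
      have h1 : ¬ (j : ℕ) < (i : ℕ) + 1 := by omega
      have h2 : ¬ (j : ℕ) < (i : ℕ) := by omega
      simp [h', h1, h2]
  simp only [cumul, this, Finset.sum_add_distrib]
  simp

theorem cumul_mono {m : ℕ} {s : Fin m → ℝ} (hs : ∀ i, 0 ≤ s i) : Monotone (cumul s) := by
  intro a b hab
  refine Finset.sum_le_sum fun j _ => ?_
  split_ifs with h1 h2
  · exact le_rfl
  · omega
  · exact hs j
  · exact le_rfl

/-- The length of the intersection of `[a, a']` and `[b, b']`. -/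
noncomputable def overlap (a a' b b' : ℝ) : ℝ := max 0 (min a' b' - max a b)

theorem overlap_comm (a a' b b' : ℝ) : overlap a a' b b' = overlap b b' a a' := by
  simp only [overlap, min_comm, max_comm]

theorem overlap_eq {a a' b b' : ℝ} (h : a ≤ a') (h' : b ≤ b') :
    overlap a a' b b' = max a (min a' b') - max a (min a' b) := by
  unfold overlap
  grind

theorem sum_overlap {n : ℕ} {t : Fin n → ℝ} (ht : ∀ i, 0 ≤ t i) (ht1 : ∑ i, t i = 1)
    {a a' : ℝ} (ha : 0 ≤ a) (haa : a ≤ a') (ha' : a' ≤ 1) :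
    ∑ j : Fin n, overlap a a' (cumul t j) (cumul t (j + 1)) = a' - a := by
  have h : ∀ j : Fin n, overlap a a' (cumul t j) (cumul t (j + 1)) =
      max a (min a' (cumul t (j + 1))) - max a (min a' (cumul t j)) := fun j =>
    overlap_eq haa (cumul_mono ht (Nat.le_succ _))
  simp_rw [h]
  rw [Fin.sum_univ_eq_sum_range
      (fun j => max a (min a' (cumul t (j + 1))) - max a (min a' (cumul t j))),
    Finset.sum_range_sub (fun j => max a (min a' (cumul t j))), cumul_top, cumul_zero, ht1,
    min_eq_left ha', max_eq_right haa, min_eq_right (ha.trans haa), max_eq_left ha]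

theorem exists_common_refinement {m n : SimplexCategory} (s : TopSimplex m) (t : TopSimplex n) :
    ∃ (k : SimplexCategory) (u : TopSimplex k) (α : k ⟶ m) (β : k ⟶ n),
      (∀ i, 0 < u i) ∧ simplexMap α u = s ∧ simplexMap β u = t := by
  classical
  have hs := fun i => stdSimplex.zero_le s i
  have ht := fun i => stdSimplex.zero_le t i
  have hs1 := stdSimplex.sum_eq_one s
  have ht1 := stdSimplex.sum_eq_one t
  let S := cumul (fun i => s i)
  let T := cumul (fun i => t i)
  have hS : Monotone S := cumul_mono hs
  have hT : Monotone T := cumul_mono ht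
  have bd : ∀ {l : ℕ} {r : Fin l → ℝ} (_ : ∀ i, 0 ≤ r i) (_ : ∑ i, r i = 1) (i : Fin l),
      0 ≤ cumul r i ∧ cumul r (i + 1) ≤ 1 := by
    intro l r h0 h1 i
    refine ⟨?_, ?_⟩
    · rw [← cumul_zero r]; exact cumul_mono h0 (Nat.zero_le _)
    · rw [← h1, ← cumul_top]; exact cumul_mono h0 i.2
  let W : Fin (m.len + 1) ×ₗ Fin (n.len + 1) → ℝ := fun p =>
    overlap (S (ofLex p).1) (S ((ofLex p).1 + 1)) (T (ofLex p).2) (T ((ofLex p).2 + 1))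
  have hW0 : ∀ p, 0 ≤ W p := fun p => le_max_left _ _
  have row : ∀ i, ∑ j, W (toLex (i, j)) = s i := by
    intro i
    have := sum_overlap ht ht1 (bd hs hs1 i).1 (hS (Nat.le_succ i)) (bd hs hs1 i).2
    refine this.trans ?_
    rw [show S (i + 1) = _ from cumul_succ _ i]
    simp
  have col : ∀ j, ∑ i, W (toLex (i, j)) = t j := by
    intro j
    have := sum_overlap hs hs1 (bd ht ht1 j).1 (hT (Nat.le_succ j)) (bd ht ht1 j).2
    refine Eq.trans (Finset.sum_congr rfl fun i _ => overlap_comm _ _ _ _) (this.trans ?_)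
    rw [show T (j + 1) = _ from cumul_succ _ j]
    simp
  let V : Finset (Fin (m.len + 1) ×ₗ Fin (n.len + 1)) := {p | 0 < W p}
  have hV : ∀ p, p ∈ V ↔ 0 < W p := fun p => by simp [V]
  have chain : ∀ p ∈ V, ∀ q ∈ V, p ≤ q → (ofLex p).1 ≤ (ofLex q).1 ∧ (ofLex p).2 ≤ (ofLex q).2 := by
    intro p hp q hq hpq
    rw [Prod.Lex.le_iff] at hpq
    rcases hpq with h | h
    · refine ⟨h.le, ?_⟩
      by_contra hlt
      rw [not_le] at hlt
      have hp' : 0 < min (S ((ofLex p).1 + 1)) (T ((ofLex p).2 + 1)) -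
          max (S (ofLex p).1) (T (ofLex p).2) := by
        exact (lt_max_iff.1 ((hV p).1 hp)).resolve_left (lt_irrefl _)
      have hq' : 0 < min (S ((ofLex q).1 + 1)) (T ((ofLex q).2 + 1)) -
          max (S (ofLex q).1) (T (ofLex q).2) := by
        exact (lt_max_iff.1 ((hV q).1 hq)).resolve_left (lt_irrefl _)
      have e1 : S ((ofLex p).1 + 1) ≤ S (ofLex q).1 := hS (Fin.lt_def.1 h)
      have e2 : T ((ofLex q).2 + 1) ≤ T (ofLex p).2 := hT (Fin.lt_def.1 hlt)
      have a1 := min_le_left (S ((ofLex p).1 + 1)) (T ((ofLex p).2 + 1))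
      have a2 := le_max_right (S (ofLex p).1) (T (ofLex p).2)
      have a3 := min_le_right (S ((ofLex q).1 + 1)) (T ((ofLex q).2 + 1))
      have a4 := le_max_left (S (ofLex q).1) (T (ofLex q).2)
      linarith
    · exact ⟨h.1.le, h.2⟩
  have total : ∑ p, W p = 1 := by
    rw [← hs1, ← (toLex (α := Fin (m.len + 1) × Fin (n.len + 1))).sum_comp,
      Fintype.sum_prod_type]
    exact Finset.sum_congr rfl fun i _ => row i
  have hVsum : ∀ P : Fin (m.len + 1) ×ₗ Fin (n.len + 1) → Prop, ∀ [DecidablePred P],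
      ∑ p ∈ V with P p, W p = ∑ p with P p, W p := by
    intro P _
    refine Finset.sum_subset (fun p hp => ?_) fun p hp hp' => ?_
    · simp only [Finset.mem_filter, Finset.mem_univ, true_and] at hp ⊢; exact hp.2
    · simp only [Finset.mem_filter, Finset.mem_univ, true_and, hV, not_and] at hp hp'
      exact le_antisymm (not_lt.1 fun h => hp' h hp) (hW0 p)
  have hne : V.Nonempty := by
    rw [Finset.nonempty_iff_ne_empty]
    intro h
    have := hVsum (fun _ => True)
    simp [h, total] at this
  obtain ⟨k, hk⟩ : ∃ k, V.card = k + 1 := Nat.exists_eq_succ_of_ne_zero hne.card_pos.ne'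
  let e := V.orderIsoOfFin hk
  have hsum : ∀ f : Fin (m.len + 1) ×ₗ Fin (n.len + 1) → ℝ, ∑ i, f (e i) = ∑ p ∈ V, f p := by
    intro f
    exact (e.toEquiv.sum_comp (fun p : V => f p)).trans (Finset.sum_coe_sort V f)
  let k' : SimplexCategory := SimplexCategory.mk k
  let u : TopSimplex k' := ⟨fun i => W (e i), fun i => hW0 _, by
    have h := hVsum (fun _ => True)
    simp only [Finset.filter_true] at h
    exact (hsum W).trans (h.trans total)⟩
  let α : k' ⟶ m := SimplexCategory.Hom.mk ⟨fun i => (ofLex (e i).1).1, fun i j hij =>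
    (chain _ (e i).2 _ (e j).2 (e.monotone hij)).1⟩
  let β : k' ⟶ n := SimplexCategory.Hom.mk ⟨fun i => (ofLex (e i).1).2, fun i j hij =>
    (chain _ (e i).2 _ (e j).2 (e.monotone hij)).2⟩
  refine ⟨k', u, α, β, fun i => (hV _).1 (e i).2, ?_, ?_⟩
  · ext i
    rw [simplexMap_apply, ← row i, Finset.sum_filter]
    refine (hsum (fun p => if (ofLex p).1 = i then W p else 0)).trans ?_
    rw [← Finset.sum_filter, hVsum, Finset.sum_filter,
      ← (toLex (α := Fin (m.len + 1) × Fin (n.len + 1))).sum_comp, Fintype.sum_prod_type,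
      Finset.sum_eq_single i]
    · simp
    · intro b _ hb; simp [hb]
    · simp
  · ext j
    rw [simplexMap_apply, ← col j, Finset.sum_filter]
    refine (hsum (fun p => if (ofLex p).2 = j then W p else 0)).trans ?_
    rw [← Finset.sum_filter, hVsum, Finset.sum_filter,
      ← (toLex (α := Fin (m.len + 1) × Fin (n.len + 1))).sum_comp, Fintype.sum_prod_type_right,
      Finset.sum_eq_single j]
    · simp
    · intro b _ hb; simp [hb]
    · simp

namespace Realization

theorem mk_refine {X : SSet.{u}} {m n : SimplexCategory} {α : m ⟶ n} (x : X.obj (op n))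
    {s : TopSimplex m} {t : TopSimplex n} (h : simplexMap α s = t) :
    mk x t = mk (X.map α.op x) s := by
  subst h; exact (glue α x s).symm

/-- Two points of `|X|` agree exactly when their representatives agree after pulling them back
to a common interior point of some simplex. -/
theorem mk_eq_mk_iff {X : SSet.{u}} {m n : SimplexCategory} (x : X.obj (op m)) (s : TopSimplex m)
    (y : X.obj (op n)) (t : TopSimplex n) :
    mk x s = mk y t ↔ ∃ (k : SimplexCategory) (u : TopSimplex k) (α : k ⟶ m) (β : k ⟶ n),
      (∀ i, 0 < u i) ∧ simplexMap α u = s ∧ simplexMap β u = t ∧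
        X.map α.op x = X.map β.op y := by
  let r : PreRealization X → PreRealization X → Prop := fun p q =>
    ∃ (k : SimplexCategory) (u : TopSimplex k) (α : k ⟶ p.1) (β : k ⟶ q.1),
      (∀ i, 0 < u i) ∧ simplexMap α u = p.2.2 ∧ simplexMap β u = q.2.2 ∧
        X.map α.op p.2.1 = X.map β.op q.2.1
  have hr : ∀ p q, Relation.EqvGen (RealizationRel X) p q → r p q := by
    intro p q h
    induction h with
    | rel p q h =>
      obtain ⟨α, x, t⟩ := h
      obtain ⟨k, u, γ, -, hu, h1, -⟩ := exists_common_refinement t t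
      refine ⟨k, u, γ, γ ≫ α, hu, h1, ?_, ?_⟩
      · rw [simplexMap_comp, h1]
      · simp
    | refl p =>
      obtain ⟨k, u, γ, -, hu, h1, -⟩ := exists_common_refinement p.2.2 p.2.2
      exact ⟨k, u, γ, γ, hu, h1, h1, rfl⟩
    | symm p q _ ih =>
      obtain ⟨k, u, α, β, hu, h1, h2, h3⟩ := ih
      exact ⟨k, u, β, α, hu, h2, h1, h3.symm⟩
    | trans p q z _ _ ih1 ih2 =>
      obtain ⟨k, u, α, β, hu, h1, h2, h3⟩ := ih1
      obtain ⟨k', u', α', β', hu', h1', h2', h3'⟩ := ih2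
      obtain ⟨l, v, γ, γ', hv, e, e'⟩ := exists_common_refinement u u'
      have hγ : γ ≫ β = γ' ≫ α' := simplexMap_injective_of_pos hv (by
        rw [simplexMap_comp, simplexMap_comp, e, e', h2, h1'])
      refine ⟨l, v, γ ≫ α, γ' ≫ β', hv, ?_, ?_, ?_⟩
      · rw [simplexMap_comp, e, h1]
      · rw [simplexMap_comp, e', h2']
      · have a1 : X.map (γ ≫ α).op p.2.1 = X.map γ.op (X.map α.op p.2.1) := by simp
        have a2 : X.map (γ' ≫ β').op z.2.1 = X.map γ'.op (X.map β'.op z.2.1) := by simp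
        have a3 : X.map γ.op (X.map β.op q.2.1) = X.map (γ ≫ β).op q.2.1 := by simp
        have a4 : X.map γ'.op (X.map α'.op q.2.1) = X.map (γ' ≫ α').op q.2.1 := by simp
        rw [a1, a2, h3, ← h3', a3, a4, hγ]
  constructor
  · intro h
    exact hr _ _ (Quot.eqvGen_exact h)
  · rintro ⟨k, u, α, β, -, h1, h2, h3⟩
    rw [mk_refine x h1, mk_refine y h2, h3]

theorem exists_common {X Y : SSet.{u}} (p : Realization X) (q : Realization Y) :
    ∃ (n : SimplexCategory) (a : X.obj (op n)) (b : Y.obj (op n)) (t : TopSimplex n),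
      p = mk a t ∧ q = mk b t := by
  induction p using ind with | _ m x s => ?_
  induction q using ind with | _ n y t => ?_
  obtain ⟨k, u, α, β, -, h1, h2⟩ := exists_common_refinement s t
  exact ⟨k, X.map α.op x, Y.map β.op y, u, mk_refine x h1, mk_refine y h2⟩

end Realization

namespace Realization

/-- Geometric realization as a functor. -/
def functor : SSet.{u} ⥤ TopCat.{u} where
  obj X := TopCat.of (Realization X)
  map f := TopCat.ofHom ⟨map f, continuous_map f⟩
  map_id X := by
    ext p
    induction p using Realization.ind with | _ n x t => rfl
  map_comp f g := by
    ext p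
    induction p using Realization.ind with | _ n x t => rfl

theorem continuous_mk {X : SSet.{u}} {n : SimplexCategory} (x : X.obj (op n)) :
    Continuous (mk x : TopSimplex n → Realization X) := by
  let _ := preTopology X
  let _ : ∀ n : SimplexCategory, TopologicalSpace (X.obj (op n)) := fun _ => ⊥
  exact continuous_coinduced_rng.comp
    ((continuous_sigmaMk (σ := fun n : SimplexCategory => X.obj (op n) × TopSimplex n)).comp
      (Continuous.prodMk_right x))

theorem continuous_of_mk {X : SSet.{u}} {Y : Type*} [TopologicalSpace Y] {f : Realization X → Y}
    (h : ∀ (n : SimplexCategory) (x : X.obj (op n)), Continuous fun t : TopSimplex n => f (mk x t)) :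
    Continuous f := by
  refine continuous_coinduced_dom.2 ?_
  let _ : ∀ n : SimplexCategory, TopologicalSpace (X.obj (op n)) := fun _ => ⊥
  have : ∀ n : SimplexCategory, DiscreteTopology (X.obj (op n)) := fun _ => ⟨rfl⟩
  refine continuous_sigma fun n => ?_
  exact continuous_prod_of_discrete_left.2 fun x => h n x

/-- Maps `|X| → Y` correspond to simplicial maps from `X` to the singular simplicial set of `Y`. -/
noncomputable def homEquiv (X : SSet.{u}) (Y : TopCat.{u}) :
    (functor.obj X ⟶ Y) ≃ (X ⟶ TopCat.toSSet.obj Y) where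
  toFun f :=
    { app n := ↾ fun x => (TopCat.toSSetObjEquiv Y n).symm
        ⟨fun t => f.hom (mk (n := n.unop) x t), f.hom.continuous.comp (continuous_mk _)⟩
      naturality m n α := by
        ext x
        apply (TopCat.toSSetObjEquiv Y n).injective
        ext t
        exact congrArg f.hom (glue α.unop x t) }
  invFun g := TopCat.ofHom
    { toFun := Quot.lift (fun p => TopCat.toSSetObjEquiv Y (op p.1) (g.app (op p.1) p.2.1) p.2.2) (by
        rintro _ _ ⟨α, x, t⟩
        dsimp only
        rw [NatTrans.naturality_apply g α.op x]
        rfl)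
      continuous_toFun := continuous_of_mk fun n x =>
        (TopCat.toSSetObjEquiv Y (op n) (g.app (op n) x)).continuous }
  left_inv f := by
    ext p
    induction p using Realization.ind with | _ n x t => rfl
  right_inv g := by
    ext n x
    apply (TopCat.toSSetObjEquiv Y n).injective
    ext t
    rfl

/-- Geometric realization is left adjoint to the singular simplicial set functor. -/
noncomputable def adjunction : functor.{u} ⊣ TopCat.toSSet.{u} :=
  Adjunction.mkOfHomEquiv
    { homEquiv := homEquiv
      homEquiv_naturality_left_symm := fun f g => by
        ext p
        induction p using Realization.ind with | _ n x t => rfl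
      homEquiv_naturality_right := fun f g => by
        ext n x
        rfl }

/-- The realization agrees with the left adjoint `SSet.toTop` of the singular simplicial set
functor. -/
noncomputable def isoToTop : functor.{u} ≅ SSet.toTop.{u} :=
  adjunction.leftAdjointUniq sSetTopAdj

end Realization

/-! ### Realization of a simplicial module -/

section SimplicialModule

variable {R : Type v} [CommRing R]

/-- The simplicial set underlying a simplicial module. -/
abbrev underlying (A : SimplicialObject (ModuleCat.{u} R)) : SSet.{u} :=
  A ⋙ forget (ModuleCat.{u} R)

/-- The geometric realization of a simplicial module. -/
def ModRealization (A : SimplicialObject (ModuleCat.{u} R)) : Type u :=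
  Realization (underlying A)

namespace ModRealization

variable {A B : SimplicialObject (ModuleCat.{u} R)}

instance : TopologicalSpace (ModRealization A) :=
  inferInstanceAs (TopologicalSpace (Realization (underlying A)))

/-- The point `[a, t]` of `|A|`. -/
def mk {n : SimplexCategory} (a : A.obj (op n)) (t : TopSimplex n) : ModRealization A :=
  Realization.mk (X := underlying A) a t

theorem ind {P : ModRealization A → Prop}
    (h : ∀ (n : SimplexCategory) (a : A.obj (op n)) (t : TopSimplex n), P (mk a t))
    (p : ModRealization A) : P p :=
  Realization.ind (X := underlying A) h p

theorem glue {m n : SimplexCategory} (α : m ⟶ n) (a : A.obj (op n)) (t : TopSimplex m) :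
    mk (A.map α.op a) t = mk a (simplexMap α t) :=
  Realization.glue (X := underlying A) α a t

theorem mk_refine {m n : SimplexCategory} {α : m ⟶ n} (a : A.obj (op n))
    {s : TopSimplex m} {t : TopSimplex n} (h : simplexMap α s = t) :
    mk a t = mk (A.map α.op a) s :=
  Realization.mk_refine (X := underlying A) a h

theorem mk_eq_mk_iff {m n : SimplexCategory} (x : A.obj (op m)) (s : TopSimplex m)
    (y : A.obj (op n)) (t : TopSimplex n) :
    mk x s = mk y t ↔ ∃ (k : SimplexCategory) (u : TopSimplex k) (α : k ⟶ m) (β : k ⟶ n),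
      (∀ i, 0 < u i) ∧ simplexMap α u = s ∧ simplexMap β u = t ∧
        A.map α.op x = A.map β.op y :=
  Realization.mk_eq_mk_iff (X := underlying A) x s y t

theorem exists_common (p q : ModRealization A) :
    ∃ (n : SimplexCategory) (a b : A.obj (op n)) (t : TopSimplex n), p = mk a t ∧ q = mk b t :=
  Realization.exists_common (X := underlying A) (Y := underlying A) p q

/-- The sum on `|A|` is given by `[a, t] + [b, t] = [a + b, t]`; see `mk_add_mk`. -/
noncomputable instance : Add (ModRealization A) where
  add p q := mk ((exists_common p q).choose_spec.choose +
      (exists_common p q).choose_spec.choose_spec.choose)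
    (exists_common p q).choose_spec.choose_spec.choose_spec.choose

theorem mk_add_mk {n : SimplexCategory} (a b : A.obj (op n)) (t : TopSimplex n) :
    mk a t + mk b t = mk (a + b) t := by
  have h := (exists_common (mk a t) (mk b t)).choose_spec.choose_spec.choose_spec.choose_spec
  change mk ((exists_common (mk a t) (mk b t)).choose_spec.choose +
      (exists_common (mk a t) (mk b t)).choose_spec.choose_spec.choose)
    (exists_common (mk a t) (mk b t)).choose_spec.choose_spec.choose_spec.choose = _
  generalize (exists_common (mk a t) (mk b t)).choose_spec.choose_spec.choose_spec.choose = t' at h ⊢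
  generalize (exists_common (mk a t) (mk b t)).choose_spec.choose_spec.choose = b' at h ⊢
  generalize (exists_common (mk a t) (mk b t)).choose_spec.choose = a' at h ⊢
  generalize (exists_common (mk a t) (mk b t)).choose = n' at t' a' b' h ⊢
  obtain ⟨h1, h2⟩ := h
  obtain ⟨k, u, α, α', hu, e1, e1', q1⟩ := (mk_eq_mk_iff _ _ _ _).1 h1
  obtain ⟨l, v, β, β', hv, e2, e2', q2⟩ := (mk_eq_mk_iff _ _ _ _).1 h2
  obtain ⟨j, w, γ, δ, hw, e3, e4⟩ := exists_common_refinement u v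
  have c1 : γ ≫ α = δ ≫ β := simplexMap_injective_of_pos hw (by
    rw [simplexMap_comp, simplexMap_comp, e3, e4, e1, e2])
  have c2 : γ ≫ α' = δ ≫ β' := simplexMap_injective_of_pos hw (by
    rw [simplexMap_comp, simplexMap_comp, e3, e4, e1', e2'])
  have r1 : A.map (γ ≫ α).op a = A.map (γ ≫ α').op a' := by
    simp only [op_comp, Functor.map_comp, ModuleCat.comp_apply, q1]
  have r2 : A.map (γ ≫ α).op b = A.map (γ ≫ α').op b' := by
    rw [c1, c2]
    simp only [op_comp, Functor.map_comp, ModuleCat.comp_apply, q2]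
  have f1 : simplexMap (γ ≫ α) w = t := by rw [simplexMap_comp, e3, e1]
  have f2 : simplexMap (γ ≫ α') w = t' := by rw [simplexMap_comp, e3, e1']
  rw [mk_refine _ f1, mk_refine _ f2, map_add, map_add, r1, r2]

/-- The zero of `|A|` is `[0, ∗]`, where `∗` is the point of `Δ⁰`. -/
noncomputable instance : Zero (ModRealization A) where
  zero := mk (n := SimplexCategory.mk 0) 0 (stdSimplex.vertex 0)

theorem mk_zero {n : SimplexCategory} (t : TopSimplex n) :
    mk (0 : A.obj (op n)) t = 0 := by
  let α : n ⟶ SimplexCategory.mk 0 := SimplexCategory.const n (SimplexCategory.mk 0) 0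
  have h := glue (A := A) α 0 t
  rw [map_zero] at h
  rw [h]
  exact congrArg (mk 0) (Subsingleton.elim (α := stdSimplex ℝ (Fin 1)) _ _)

/-- The continuous map `|f| : |A| → |B|`, `[a, t] ↦ [f a, t]`. -/
def map (f : A ⟶ B) : ModRealization A → ModRealization B :=
  Realization.map (Functor.whiskerRight f (forget (ModuleCat.{u} R)))

theorem map_mk (f : A ⟶ B) {n : SimplexCategory} (a : A.obj (op n)) (t : TopSimplex n) :
    map f (mk a t) = mk (f.app (op n) a) t := rfl

noncomputable instance : Neg (ModRealization A) where
  neg := map (-𝟙 A)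

theorem neg_mk {n : SimplexCategory} (a : A.obj (op n)) (t : TopSimplex n) :
    -mk a t = mk (-a) t := by
  refine (map_mk _ _ _).trans ?_
  simp

noncomputable instance : AddCommGroup (ModRealization A) where
  add_assoc p q r := by
    obtain ⟨n, a, b, t, rfl, rfl⟩ := exists_common p q
    induction r using ind with | _ m c s => ?_
    obtain ⟨k, u, α, β, -, h1, h2⟩ := exists_common_refinement t s
    rw [mk_refine a h1, mk_refine b h1, mk_refine c h2]
    simp only [mk_add_mk, add_assoc]
  zero_add p := by
    induction p using ind with | _ n a t => ?_
    rw [← mk_zero t, mk_add_mk, zero_add]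
  add_zero p := by
    induction p using ind with | _ n a t => ?_
    rw [← mk_zero t, mk_add_mk, add_zero]
  nsmul := nsmulRec
  zsmul := zsmulRec
  neg_add_cancel p := by
    induction p using ind with | _ n a t => ?_
    rw [neg_mk, mk_add_mk, neg_add_cancel, mk_zero]
  add_comm p q := by
    obtain ⟨n, a, b, t, rfl, rfl⟩ := exists_common p q
    rw [mk_add_mk, mk_add_mk, add_comm]

end ModRealization

end SimplicialModule

/-! ### The orbit category and pointed `G`-sets -/

section Orbit

variable (G : Type w) [Group G]

/-- The category of orbits `G/H`, `H ⊆ G`, and `G`-functions between them. An object is given by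
the subgroup `H`. -/
structure OrbitCat where
  /-- The subgroup `H`. -/
  stab : Subgroup G

instance : Category (OrbitCat G) where
  Hom H K := (G ⧸ H.stab) →[G] (G ⧸ K.stab)
  id _ := MulActionHom.id G
  comp f g := g.comp f

/-- A pointed `G`-set: a `G`-set with a base point fixed by `G`. -/
structure PtGSet where
  /-- The underlying set. -/
  carrier : Type u
  [action : MulAction G carrier]
  /-- The base point. -/
  pt : carrier
  smul_pt : ∀ g : G, g • pt = pt

attribute [instance] PtGSet.action

variable {G}

namespace PtGSet

instance : CoeSort (PtGSet.{u} G) (Type u) := ⟨PtGSet.carrier⟩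

/-- A pointed `G`-function. -/
@[ext]
structure Hom (S T : PtGSet.{u} G) where
  /-- The underlying function. -/
  toFun : S → T
  map_smul : ∀ (g : G) (x : S), toFun (g • x) = g • toFun x
  map_pt : toFun S.pt = T.pt

instance : Category (PtGSet.{u} G) where
  Hom := Hom
  id S := ⟨id, fun _ _ => rfl, rfl⟩
  comp f g := ⟨g.toFun ∘ f.toFun, fun a x => by simp [f.map_smul, g.map_smul],
    by simp [f.map_pt, g.map_pt]⟩

variable (G) in
/-- The functor forgetting the action and the base point. -/
def toType : PtGSet.{u} G ⥤ Type u where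
  obj S := S.carrier
  map f := ↾ f.toFun

theorem stabilizer_le {S T : PtGSet.{u} G} (f : S ⟶ T) (x : S) :
    MulAction.stabilizer G x ≤ MulAction.stabilizer G (f.toFun x) := by
  intro g hg
  rw [MulAction.mem_stabilizer_iff] at hg ⊢
  rw [← f.map_smul, hg]

end PtGSet

namespace OrbitCat

/-- The orbit `G/H` as an object of the orbit category. -/
abbrev of (H : Subgroup G) : OrbitCat G := ⟨H⟩

/-- The `G`-function `G/H → G/K`, `aH ↦ acK`, for `c` such that `c⁻¹ H c ⊆ K`. -/
def rightMul {H K : Subgroup G} (c : G) (h : ∀ a ∈ H, c⁻¹ * a * c ∈ K) : of H ⟶ of K where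
  toFun := Quotient.map' (fun a => a * c) (by
    intro a b hab
    rw [QuotientGroup.leftRel_apply] at hab ⊢
    simpa [mul_assoc] using h _ hab)
  map_smul' g := by
    rintro ⟨a⟩
    exact congrArg (QuotientGroup.mk (s := K)) (mul_assoc g a c)

/-- The `G`-function underlying a morphism of the orbit category. -/
def toFun {H K : OrbitCat G} (f : H ⟶ K) : (G ⧸ H.stab) →[G] (G ⧸ K.stab) := f

theorem rightMul_mk {H K : Subgroup G} (c : G) (h : ∀ a ∈ H, c⁻¹ * a * c ∈ K) (a : G) :
    toFun (rightMul c h) (QuotientGroup.mk a) = QuotientGroup.mk (a * c) := rfl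

theorem hom_ext {H K : Subgroup G} {f g : of H ⟶ of K}
    (h : ∀ a : G, toFun f (QuotientGroup.mk a) = toFun g (QuotientGroup.mk a)) : f = g := by
  refine MulActionHom.ext ?_
  rintro ⟨a⟩
  exact h a

theorem rightMul_comp {H K L : Subgroup G} (c d : G) (h : ∀ a ∈ H, c⁻¹ * a * c ∈ K)
    (h' : ∀ a ∈ K, d⁻¹ * a * d ∈ L) (h'' : ∀ a ∈ H, (c * d)⁻¹ * a * (c * d) ∈ L) :
    rightMul c h ≫ rightMul d h' = rightMul (c * d) h'' :=
  hom_ext fun a => congrArg (QuotientGroup.mk (s := L)) (mul_assoc a c d)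

/-- The canonical projection `G/H → G/K`, `aH ↦ aK`, for `H ⊆ K`. -/
def proj {H K : Subgroup G} (h : H ≤ K) : of H ⟶ of K :=
  rightMul 1 fun a ha => by simpa using h ha

theorem proj_refl (H : Subgroup G) : proj (le_refl H) = 𝟙 (of H) :=
  hom_ext fun a => congrArg (QuotientGroup.mk (s := H)) (mul_one a)

/-- The right translation `R_{g⁻¹} : G/Gₓ → G/G_{gx}`, `aGₓ ↦ ag⁻¹G_{gx}`. -/
def translate {S : Type u} [MulAction G S] (g : G) (x : S) :
    of (MulAction.stabilizer G x) ⟶ of (MulAction.stabilizer G (g • x)) :=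
  rightMul g⁻¹ fun a ha => by
    rw [MulAction.mem_stabilizer_iff] at ha ⊢
    simp [mul_smul, ha]

end OrbitCat

end Orbit

/-! ### Finitely supported functions vanishing at a point -/

section PtFin

/-- The module of functions `u` with `u s ∈ A s`, `u pt = 0` and `u s = 0` for almost every `s`. -/
abbrev PtFin (R : Type v) [CommRing R] {S : Type u} (pt : S) (A : S → Type u)
    [∀ s, AddCommGroup (A s)] [∀ s, Module R (A s)] : Type u :=
  LinearMap.ker (DFinsupp.lapply pt : (Π₀ s, A s) →ₗ[R] A pt)

namespace PtFin

variable {R : Type v} [CommRing R] {S : Type u} {pt : S} {A : S → Type u}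
  [∀ s, AddCommGroup (A s)] [∀ s, Module R (A s)]

open scoped Classical in
/-- The element `l s`: the function with value `l` at `s` and `0` elsewhere if `s ≠ pt`, and the
zero function if `s = pt`. -/
noncomputable def gen (s : S) : A s →ₗ[R] PtFin R pt A :=
  if h : s = pt then 0
  else LinearMap.codRestrict _ (DFinsupp.lsingle s) fun l => by simp [h]

theorem gen_apply_of_ne {s : S} (hs : s ≠ pt) (l : A s) [DecidableEq S] :
    (gen (R := R) (pt := pt) s l : Π₀ s, A s) = DFinsupp.single s l := by
  unfold gen
  rw [dif_neg hs]
  obtain rfl : ‹DecidableEq S› = fun a b => Classical.propDecidable (a = b) :=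
    Subsingleton.elim _ _
  rfl

theorem gen_pt (l : A pt) : gen (R := R) (pt := pt) pt l = 0 := by
  simp [gen]

theorem gen_apply_self {s : S} (hs : s ≠ pt) (l : A s) :
    (gen (R := R) (pt := pt) s l : Π₀ s, A s) s = l := by
  classical
  rw [gen_apply_of_ne hs, DFinsupp.single_eq_same]

theorem gen_apply_ne {s s' : S} (h : s ≠ s') (l : A s) :
    (gen (R := R) (pt := pt) s l : Π₀ s, A s) s' = 0 := by
  classical
  by_cases hs : s = pt
  · subst hs
    rw [gen_pt]
    rfl
  · rw [gen_apply_of_ne hs, DFinsupp.single_eq_of_ne h.symm]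

theorem apply_pt (u : PtFin R pt A) : (u : Π₀ s, A s) pt = 0 := LinearMap.mem_ker.1 u.2

variable {N : Type*} [AddCommGroup N] [Module R N]

open scoped Classical in
/-- The homomorphism with prescribed values on the generators. -/
noncomputable def lift (φ : ∀ s, A s →ₗ[R] N) : PtFin R pt A →ₗ[R] N :=
  (DFinsupp.lsum ℕ φ) ∘ₗ Submodule.subtype _

theorem lift_gen (φ : ∀ s, A s →ₗ[R] N) (hφ : ∀ l, φ pt l = 0) (s : S) (l : A s) :
    lift φ (gen (pt := pt) s l) = φ s l := by
  classical
  by_cases hs : s = pt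
  · subst hs
    rw [gen_pt, map_zero, hφ]
  · simp only [lift, LinearMap.comp_apply, Submodule.subtype_apply, gen_apply_of_ne hs]
    convert DFinsupp.lsum_single ℕ φ s l

theorem induction_on {P : PtFin R pt A → Prop} (zero : P 0) (gen : ∀ s l, P (gen s l))
    (add : ∀ u v, P u → P v → P (u + v)) (u : PtFin R pt A) : P u := by
  classical
  have key : ∀ v : Π₀ s, A s, ∃ w : PtFin R pt A, P w ∧
      ∀ s, s ≠ pt → (w : Π₀ s, A s) s = v s := by
    intro v
    induction v using DFinsupp.induction with
    | h0 => exact ⟨0, zero, fun _ _ => rfl⟩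
    | @ha s l v _ _ ih =>
      obtain ⟨w, hw, hw'⟩ := ih
      refine ⟨PtFin.gen s l + w, add _ _ (gen s l) hw, fun s' hs' => ?_⟩
      rw [Submodule.coe_add, DFinsupp.add_apply, DFinsupp.add_apply, hw' s' hs']
      by_cases hs : s = pt
      · subst hs
        rw [gen_pt]
        simp [hs'.symm]
      · rw [gen_apply_of_ne hs]
  obtain ⟨w, hw, hw'⟩ := key u
  have : w = u := by
    refine Subtype.ext (DFinsupp.ext fun s => ?_)
    by_cases hs : s = pt
    · subst hs
      exact (LinearMap.mem_ker.1 w.2).trans (LinearMap.mem_ker.1 u.2).symm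
    · exact hw' s hs
  exact this ▸ hw

theorem hom_ext {f g : PtFin R pt A →ₗ[R] N} (h : ∀ s l, f (gen s l) = g (gen s l)) : f = g := by
  refine LinearMap.ext fun u => ?_
  induction u using induction_on with
  | zero => simp
  | gen s l => exact h s l
  | add u v hu hv => rw [map_add, map_add, hu, hv]

end PtFin

end PtFin

/-! ### The groups `F(S, M)` -/

section Coefficients

variable {G : Type w} [Group G] {R : Type v} [CommRing R] (M : OrbitCat G ⥤ ModuleCat.{u} R)

/-- The module `M(G/Gₓ)`. -/
abbrev coeffAt {S : Type u} [MulAction G S] (x : S) : Type u :=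
  M.obj (OrbitCat.of (MulAction.stabilizer G x))

/-- `F(S, M)`: the module of functions `u` on the pointed `G`-set `S` with `u x ∈ M(G/Gₓ)`, which
vanish at the base point and almost everywhere. -/
abbrev F (S : PtGSet.{u} G) : Type u := PtFin R S.pt (fun x : S => coeffAt M x)

variable {M}

/-- The generator `l x` of `F(S, M)`, which is `0` if `x` is the base point. -/
noncomputable abbrev F.gen {S : PtGSet.{u} G} (x : S) : coeffAt M x →ₗ[R] F M S := PtFin.gen x

theorem F.gen_rightMul_congr {S : PtGSet.{u} G} {H : Subgroup G} {x y : S} (e : x = y) {c d : G}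
    (hc : ∀ a ∈ H, c⁻¹ * a * c ∈ MulAction.stabilizer G x)
    (hd : ∀ a ∈ H, d⁻¹ * a * d ∈ MulAction.stabilizer G y)
    (hcd : c⁻¹ * d ∈ MulAction.stabilizer G x) (l : M.obj (OrbitCat.of H)) :
    F.gen x (M.map (OrbitCat.rightMul c hc) l) = F.gen y (M.map (OrbitCat.rightMul d hd) l) := by
  subst e
  have : OrbitCat.rightMul c hc = OrbitCat.rightMul d hd := OrbitCat.hom_ext fun a => by
    rw [OrbitCat.rightMul_mk, OrbitCat.rightMul_mk, QuotientGroup.eq]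
    simpa [mul_assoc] using hcd
  rw [this]

theorem F.gen_pt_eq_zero {S : PtGSet.{u} G} {x : S} (h : x = S.pt) (l : coeffAt M x) :
    F.gen x l = 0 := by
  subst h; exact PtFin.gen_pt l

variable (M)

/-- The homomorphism `f_* : F(S, M) → F(T, M)`, `f_*(l x) = M_*(f̂ₓ)(l) f(x)`, where
`f̂ₓ : G/Gₓ → G/G_{f(x)}` is the canonical projection. -/
noncomputable def F.map {S T : PtGSet.{u} G} (f : S ⟶ T) : F M S →ₗ[R] F M T :=
  PtFin.lift fun x =>
    F.gen (f.toFun x) ∘ₗ (M.map (OrbitCat.proj (PtGSet.stabilizer_le f x))).hom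

theorem F.map_gen {S T : PtGSet.{u} G} (f : S ⟶ T) (x : S) (l : coeffAt M x) :
    F.map M f (F.gen x l) =
      F.gen (f.toFun x) (M.map (OrbitCat.proj (PtGSet.stabilizer_le f x)) l) :=
  PtFin.lift_gen (fun x => F.gen (f.toFun x) ∘ₗ
    (M.map (OrbitCat.proj (PtGSet.stabilizer_le f x))).hom)
    (fun _ => F.gen_pt_eq_zero f.map_pt _) x l

theorem F.map_id (S : PtGSet.{u} G) : F.map M (𝟙 S) = LinearMap.id := by
  refine PtFin.hom_ext fun x l => (F.map_gen M _ x l).trans ?_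
  have : OrbitCat.proj (PtGSet.stabilizer_le (𝟙 S) x) = 𝟙 _ := OrbitCat.proj_refl _
  rw [this, M.map_id]
  rfl

theorem F.map_comp {S T U : PtGSet.{u} G} (f : S ⟶ T) (g : T ⟶ U) :
    F.map M (f ≫ g) = F.map M g ∘ₗ F.map M f := by
  refine PtFin.hom_ext fun x l => ?_
  rw [LinearMap.comp_apply]
  refine (F.map_gen M _ x l).trans ?_
  refine Eq.trans ?_ ((congrArg _ (F.map_gen M f x l)).trans (F.map_gen M g _ _)).symm
  have : OrbitCat.proj (PtGSet.stabilizer_le (f ≫ g) x) =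
      OrbitCat.proj (PtGSet.stabilizer_le f x) ≫ OrbitCat.proj (PtGSet.stabilizer_le g _) :=
    OrbitCat.hom_ext fun a => congrArg QuotientGroup.mk (by simp)
  rw [this, M.map_comp]
  rfl

/-- The functor `F(-, M)`. -/
noncomputable def FFunctor : PtGSet.{u} G ⥤ ModuleCat.{u} R where
  obj S := ModuleCat.of R (F M S)
  map f := ModuleCat.ofHom (F.map M f)
  map_id S := by rw [F.map_id]; rfl
  map_comp f g := by rw [F.map_comp]; rfl

/-- The action of `g` on `F(S, M)`, `g · (l x) = M_*(R_{g⁻¹})(l) (g x)`. -/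
noncomputable def F.act (S : PtGSet.{u} G) (g : G) : F M S →ₗ[R] F M S :=
  PtFin.lift fun x => F.gen (g • x) ∘ₗ (M.map (OrbitCat.translate g x)).hom

theorem F.act_gen {S : PtGSet.{u} G} (g : G) (x : S) (l : coeffAt M x) :
    F.act M S g (F.gen x l) = F.gen (g • x) (M.map (OrbitCat.translate g x) l) :=
  PtFin.lift_gen (fun x => F.gen (g • x) ∘ₗ (M.map (OrbitCat.translate g x)).hom)
    (fun _ => F.gen_pt_eq_zero (S.smul_pt g) _) x l

theorem F.act_act (S : PtGSet.{u} G) (g h : G) (u : F M S) :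
    F.act M S g (F.act M S h u) = F.act M S (g * h) u := by
  suffices F.act M S g ∘ₗ F.act M S h = F.act M S (g * h) from LinearMap.congr_fun this u
  refine PtFin.hom_ext fun x l => ?_
  rw [LinearMap.comp_apply]
  refine ((congrArg _ (F.act_gen M h x l)).trans (F.act_gen M g _ _)).trans
    (Eq.trans ?_ (F.act_gen M (g * h) x l).symm)
  rw [← ModuleCat.comp_apply, ← M.map_comp]
  unfold OrbitCat.translate
  rw [OrbitCat.rightMul_comp _ _ _ _ (fun a ha => by
    rw [MulAction.mem_stabilizer_iff] at ha ⊢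
    simp [mul_smul, ha])]
  exact F.gen_rightMul_congr (mul_smul g h x).symm _ _ (by simp) l

theorem F.act_one (S : PtGSet.{u} G) (u : F M S) : F.act M S 1 u = u := by
  suffices F.act M S 1 = LinearMap.id from LinearMap.congr_fun this u
  refine PtFin.hom_ext fun x l => (F.act_gen M 1 x l).trans ?_
  have h : F.gen x (M.map (OrbitCat.proj (le_refl _)) l) = F.gen x l := by
    rw [OrbitCat.proj_refl, M.map_id]; rfl
  exact (F.gen_rightMul_congr (one_smul G x) _ _ (by simp) l).trans h

theorem F.map_act {S T : PtGSet.{u} G} (f : S ⟶ T) (g : G) (u : F M S) :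
    F.map M f (F.act M S g u) = F.act M T g (F.map M f u) := by
  suffices F.map M f ∘ₗ F.act M S g = F.act M T g ∘ₗ F.map M f from LinearMap.congr_fun this u
  refine PtFin.hom_ext fun x l => ?_
  rw [LinearMap.comp_apply, LinearMap.comp_apply]
  refine ((congrArg _ (F.act_gen M g x l)).trans (F.map_gen M f _ _)).trans
    (Eq.trans ?_ ((congrArg _ (F.map_gen M f x l)).trans (F.act_gen M g _ _)).symm)
  rw [← ModuleCat.comp_apply, ← M.map_comp, ← ModuleCat.comp_apply, ← M.map_comp]
  have h : ∀ a ∈ MulAction.stabilizer G x,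
      (g⁻¹)⁻¹ * a * g⁻¹ ∈ MulAction.stabilizer G (g • f.toFun x) := fun a ha => by
    have := PtGSet.stabilizer_le f x ha
    rw [MulAction.mem_stabilizer_iff] at this ⊢
    simp [mul_smul, this]
  have h' : ∀ a ∈ MulAction.stabilizer G x,
      (g⁻¹)⁻¹ * a * g⁻¹ ∈ MulAction.stabilizer G (f.toFun (g • x)) := by
    rw [f.map_smul]; exact h
  have e1 : OrbitCat.translate g x ≫ OrbitCat.proj (PtGSet.stabilizer_le f (g • x)) =
      OrbitCat.rightMul g⁻¹ h' :=
    OrbitCat.hom_ext fun a => congrArg QuotientGroup.mk (mul_one _)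
  have e2 : OrbitCat.proj (PtGSet.stabilizer_le f x) ≫ OrbitCat.translate g (f.toFun x) =
      OrbitCat.rightMul g⁻¹ h :=
    OrbitCat.hom_ext fun a => congrArg (fun b => QuotientGroup.mk (b * g⁻¹)) (mul_one _)
  rw [e1, e2]
  exact F.gen_rightMul_congr (f.map_smul g x) _ _ (by simp) l

/-- The submodule `F(S, M)ᴳ` of fixed points. -/
noncomputable def F.invariants (S : PtGSet.{u} G) : Submodule R (F M S) where
  carrier := {u | ∀ g, F.act M S g u = u}
  zero_mem' g := map_zero _
  add_mem' hu hv g := by rw [map_add, hu g, hv g]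
  smul_mem' r u hu g := by rw [map_smul, hu g]

theorem F.mem_invariants {S : PtGSet.{u} G} {u : F M S} :
    u ∈ F.invariants M S ↔ ∀ g, F.act M S g u = u := Iff.rfl

/-- The restriction `f̄ᴳ_* : F(S, M)ᴳ → F(T, M)ᴳ` of `f_*`. -/
noncomputable def F.mapInvariants {S T : PtGSet.{u} G} (f : S ⟶ T) :
    F.invariants M S →ₗ[R] F.invariants M T :=
  (F.map M f).restrict fun u hu g => by rw [← F.map_act, hu g]

/-- The functor `F̄ᴳ(-, M)`. -/
noncomputable def FBarFunctor : PtGSet.{u} G ⥤ ModuleCat.{u} R where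
  obj S := ModuleCat.of R (F.invariants M S)
  map f := ModuleCat.ofHom (F.mapInvariants M f)
  map_id S := ModuleCat.hom_ext (LinearMap.ext fun u => Subtype.ext
    (LinearMap.congr_fun (F.map_id M S) u.1))
  map_comp f g := ModuleCat.hom_ext (LinearMap.ext fun u => Subtype.ext
    (LinearMap.congr_fun (F.map_comp M f g) u.1))

/-- The inclusion `ι_S : F̄ᴳ(S, M) → F(S, M)`, as a natural transformation. -/
noncomputable def iotaNat : FBarFunctor M ⟶ FFunctor M where
  app S := ModuleCat.ofHom (F.invariants M S).subtype
  naturality _ _ _ := rfl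

theorem F.act_gen_congr {S : PtGSet.{u} G} {x : S} {g h : G}
    (e : (QuotientGroup.mk g : G ⧸ MulAction.stabilizer G x) = QuotientGroup.mk h)
    (l : coeffAt M x) : F.act M S g (F.gen x l) = F.act M S h (F.gen x l) := by
  rw [QuotientGroup.eq] at e
  have e' : g • x = h • x := by
    rw [MulAction.mem_stabilizer_iff, mul_smul] at e
    exact (inv_smul_eq_iff.1 e).symm
  rw [F.act_gen, F.act_gen]
  refine F.gen_rightMul_congr e' _ _ ?_ l
  rw [MulAction.mem_stabilizer_iff, inv_inv, mul_smul, ← mul_smul h⁻¹ g x, mul_smul, e',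
    inv_smul_smul]
  exact e'

theorem F.act_apply_smul {S : PtGSet.{u} G} (g : G) (u : F M S) (x : S) :
    (F.act M S g u : Π₀ y : S, coeffAt M y) (g • x) =
      M.map (OrbitCat.translate g x) ((u : Π₀ y : S, coeffAt M y) x) := by
  by_cases hx : x = S.pt
  · have h : g • x = S.pt := by rw [hx, S.smul_pt]
    have h1 : ∀ (v : F M S) (y : S), y = S.pt → (v : Π₀ y : S, coeffAt M y) y = 0 := by
      rintro v y rfl
      exact PtFin.apply_pt v
    rw [h1 _ _ h, h1 _ _ hx, map_zero]
  · have hgx : g • x ≠ S.pt := fun h => hx (by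
      rw [← inv_smul_smul g x, h, S.smul_pt])
    induction u using PtFin.induction_on with
    | zero => simp
    | gen z l =>
      rw [F.act_gen]
      by_cases hz : z = x
      · subst hz
        rw [PtFin.gen_apply_self hgx, PtFin.gen_apply_self hx]
      · rw [PtFin.gen_apply_ne hz, map_zero,
          PtFin.gen_apply_ne fun h => hz (smul_left_cancel g h)]
    | add u v hu hv =>
      rw [map_add, Submodule.coe_add, DFinsupp.add_apply, hu, hv, Submodule.coe_add,
        DFinsupp.add_apply, map_add]

/-- A representative of the orbit of `x`. -/
noncomputable def orbitRep {S : PtGSet.{u} G} (x : S) : S :=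
  (Quotient.mk (MulAction.orbitRel G S) x).out

theorem exists_smul_eq_orbitRep {S : PtGSet.{u} G} (x : S) : ∃ g : G, g • x = orbitRep x :=
  Quotient.exact (Quotient.out_eq (Quotient.mk (MulAction.orbitRel G S) x))

theorem orbitRep_smul {S : PtGSet.{u} G} (g : G) (x : S) : orbitRep (g • x) = orbitRep x :=
  congrArg Quotient.out (Quotient.sound (s := MulAction.orbitRel G S) ⟨g, rfl⟩)

theorem orbitRep_orbitRep {S : PtGSet.{u} G} (x : S) : orbitRep (orbitRep x) = orbitRep x := by
  obtain ⟨g, hg⟩ := exists_smul_eq_orbitRep x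
  rw [← hg, orbitRep_smul, hg]

variable [Finite G]

open scoped Classical in
/-- `γᴳₓ(l) = ∑_{[g] ∈ G/Gₓ} M_*(R_{g⁻¹})(l) (g x)`. The sum runs over the cosets `q`, of which
`q.out` is a representative. -/
noncomputable def F.gamma {S : PtGSet.{u} G} (x : S) : coeffAt M x →ₗ[R] F M S :=
  letI := Fintype.ofFinite (G ⧸ MulAction.stabilizer G x)
  ∑ q : G ⧸ MulAction.stabilizer G x,
    F.gen (q.out • x) ∘ₗ (M.map (OrbitCat.translate q.out x)).hom

theorem F.gamma_apply {S : PtGSet.{u} G} (x : S) (l : coeffAt M x)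
    [Fintype (G ⧸ MulAction.stabilizer G x)] :
    F.gamma M x l = ∑ q : G ⧸ MulAction.stabilizer G x, F.act M S q.out (F.gen x l) := by
  unfold F.gamma
  rw [LinearMap.sum_apply]
  refine Finset.sum_congr (by congr!) fun q _ => (F.act_gen M _ x l).symm

theorem F.act_gamma {S : PtGSet.{u} G} (g : G) (x : S) (l : coeffAt M x) :
    F.act M S g (F.gamma M x l) = F.gamma M x l := by
  let _ := Fintype.ofFinite (G ⧸ MulAction.stabilizer G x)
  rw [F.gamma_apply, map_sum]
  refine Fintype.sum_equiv (MulAction.toPerm g) _ _ fun q => ?_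
  rw [F.act_act]
  refine F.act_gen_congr M ?_ l
  rw [MulAction.toPerm_apply, QuotientGroup.out_eq']
  conv_rhs => rw [← QuotientGroup.out_eq' q]
  rfl

/-- The homomorphism `β_S : F(S, M) → F(S, M)ᴳ`, `β_S(l x) = γᴳₓ(l)`. -/
noncomputable def F.beta (S : PtGSet.{u} G) : F M S →ₗ[R] F.invariants M S :=
  LinearMap.codRestrict _ (PtFin.lift fun x => F.gamma M x) fun u g => by
    suffices F.act M S g ∘ₗ PtFin.lift (fun x => F.gamma M x) = PtFin.lift fun x => F.gamma M x from
      LinearMap.congr_fun this u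
    refine PtFin.hom_ext fun x l => ?_
    have h : ∀ l, F.gamma M S.pt l = 0 := fun l => by
      let _ := Fintype.ofFinite (G ⧸ MulAction.stabilizer G S.pt)
      rw [F.gamma_apply]
      refine Finset.sum_eq_zero fun q _ => ?_
      rw [F.gen_pt_eq_zero rfl, map_zero]
    rw [LinearMap.comp_apply, PtFin.lift_gen _ h, F.act_gamma]

theorem F.beta_gen {S : PtGSet.{u} G} (x : S) (l : coeffAt M x) :
    (F.beta M S (F.gen x l) : F M S) = F.gamma M x l := by
  refine PtFin.lift_gen _ (fun l => ?_) x l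
  let _ := Fintype.ofFinite (G ⧸ MulAction.stabilizer G S.pt)
  rw [F.gamma_apply]
  refine Finset.sum_eq_zero fun q _ => ?_
  rw [F.gen_pt_eq_zero rfl, map_zero]

theorem F.beta_act (S : PtGSet.{u} G) (g : G) (u : F M S) :
    F.beta M S (F.act M S g u) = F.beta M S u := by
  suffices F.beta M S ∘ₗ F.act M S g = F.beta M S from LinearMap.congr_fun this u
  refine PtFin.hom_ext (N := F.invariants M S) fun x l => ?_
  apply Subtype.ext
  rw [LinearMap.comp_apply, F.act_gen, F.beta_gen, F.beta_gen]
  let _ := Fintype.ofFinite (G ⧸ MulAction.stabilizer G x)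
  let _ := Fintype.ofFinite (G ⧸ MulAction.stabilizer G (g • x))
  rw [F.gamma_apply, F.gamma_apply]
  have hm : ∀ {y : S} {a b : G}, (QuotientGroup.mk a : G ⧸ MulAction.stabilizer G y) =
      QuotientGroup.mk b ↔ a • y = b • y := by
    intro y a b
    rw [QuotientGroup.eq, MulAction.mem_stabilizer_iff, mul_smul, inv_smul_eq_iff, eq_comm]
  let e : (G ⧸ MulAction.stabilizer G (g • x)) ≃ (G ⧸ MulAction.stabilizer G x) :=
    Equiv.ofBijective (fun q => QuotientGroup.mk (q.out * g)) (by
      refine ⟨fun q r h => ?_, fun q => ⟨QuotientGroup.mk (q.out * g⁻¹), ?_⟩⟩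
      · dsimp only at h
        rw [hm, mul_smul, mul_smul, ← hm, QuotientGroup.out_eq', QuotientGroup.out_eq'] at h
        exact h
      · dsimp only
        conv_rhs => rw [← QuotientGroup.out_eq' q]
        rw [hm, mul_smul, ← hm.1 (QuotientGroup.out_eq'
          (QuotientGroup.mk (q.out * g⁻¹) : G ⧸ MulAction.stabilizer G (g • x))).symm]
        simp [mul_smul])
  refine Fintype.sum_equiv e _ _ fun q => ?_
  rw [← F.act_gen, F.act_act]
  refine F.act_gen_congr M ?_ l
  exact (QuotientGroup.out_eq' _).symm

theorem F.beta_gen_apply {S : PtGSet.{u} G} {x y : S} (hx : orbitRep x = x) (hy : orbitRep y = y)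
    (l : coeffAt M x) :
    ((F.beta M S (F.gen x l) : F M S) : Π₀ y : S, coeffAt M y) y =
      (F.gen x l : Π₀ y : S, coeffAt M y) y := by
  rw [F.beta_gen]
  let _ := Fintype.ofFinite (G ⧸ MulAction.stabilizer G x)
  rw [F.gamma_apply, Submodule.coe_sum, DFinsupp.finsetSum_apply]
  rw [Finset.sum_eq_single (QuotientGroup.mk 1 : G ⧸ MulAction.stabilizer G x)]
  · rw [F.act_gen_congr M (QuotientGroup.out_eq' _), F.act_one]
  · intro q _ hq
    rw [F.act_gen]
    refine PtFin.gen_apply_ne (fun h => ?_) _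
    have hxy : x = y := by rw [← hx, ← hy, ← h, orbitRep_smul]
    apply hq
    rw [← QuotientGroup.out_eq' q, QuotientGroup.eq, mul_one, MulAction.mem_stabilizer_iff,
      inv_smul_eq_iff, h, hxy]
  · intro h
    exact absurd (Finset.mem_univ _) h

theorem F.ker_beta_le {S T : PtGSet.{u} G} (f : S ⟶ T) :
    LinearMap.ker (F.beta M S) ≤ LinearMap.ker (F.beta M T ∘ₗ F.map M f) := by
  choose c hc using fun x : S => exists_smul_eq_orbitRep x
  let ρ : F M S →ₗ[R] F M S := PtFin.lift fun x => F.act M S (c x) ∘ₗ F.gen x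
  have hρ : ∀ x l, ρ (F.gen x l) = F.act M S (c x) (F.gen x l) := fun x l =>
    PtFin.lift_gen (fun x : S => F.act M S (c x) ∘ₗ F.gen x) (fun l => by
      rw [LinearMap.comp_apply, F.gen_pt_eq_zero rfl, map_zero]) x l
  have h1 : F.beta M S ∘ₗ ρ = F.beta M S :=
    PtFin.hom_ext (N := F.invariants M S) fun x l => by
      rw [LinearMap.comp_apply]
      exact (congrArg _ (hρ x l)).trans (F.beta_act M S _ _)
  have h2 : (F.beta M T ∘ₗ F.map M f) ∘ₗ ρ = F.beta M T ∘ₗ F.map M f :=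
    PtFin.hom_ext (N := F.invariants M T) fun x l => by
      rw [LinearMap.comp_apply, LinearMap.comp_apply, LinearMap.comp_apply]
      refine (congrArg (fun v => F.beta M T (F.map M f v)) (hρ x l)).trans ?_
      rw [F.map_act, F.beta_act]
  have h3 : ∀ (u : F M S) (y : S), orbitRep y ≠ y → (ρ u : Π₀ y : S, coeffAt M y) y = 0 := by
    intro u y hy
    induction u using PtFin.induction_on with
    | zero => simp
    | gen x l =>
      rw [hρ, F.act_gen]
      refine PtFin.gen_apply_ne (fun h => hy ?_) _
      rw [← h, hc, orbitRep_orbitRep]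
    | add u v hu hv => rw [map_add, Submodule.coe_add, DFinsupp.add_apply, hu, hv, add_zero]
  have h4 : ∀ (u : F M S) (y : S), orbitRep y = y →
      ((F.beta M S (ρ u) : F M S) : Π₀ y : S, coeffAt M y) y =
        (ρ u : Π₀ y : S, coeffAt M y) y := by
    intro u y hy
    induction u using PtFin.induction_on with
    | zero => simp
    | gen x l =>
      rw [hρ, F.act_gen]
      exact F.beta_gen_apply M (by rw [hc, orbitRep_orbitRep]) hy _
    | add u v hu hv =>
      rw [map_add, map_add, Submodule.coe_add, Submodule.coe_add, DFinsupp.add_apply, hu, hv,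
        Submodule.coe_add, DFinsupp.add_apply]
  intro u hu
  rw [LinearMap.mem_ker] at hu ⊢
  have h5 : ρ u = 0 := by
    refine Subtype.ext (DFinsupp.ext fun y => ?_)
    by_cases hy : orbitRep y = y
    · rw [← h4 u y hy, ← LinearMap.comp_apply, h1, hu]
      rfl
    · exact h3 u y hy
  rw [← h2, LinearMap.comp_apply, h5, map_zero]

theorem F.beta_surjective (S : PtGSet.{u} G) : Function.Surjective (F.beta M S) := by
  classical
  let π : F M S →ₗ[R] F M S := PtFin.lift fun x => if orbitRep x = x then F.gen x else 0
  have hπ : ∀ x l, π (F.gen x l) = if orbitRep x = x then F.gen x l else 0 := fun x l =>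
    (PtFin.lift_gen (fun x : S => if orbitRep x = x then F.gen x else 0) (fun l => by
      split_ifs
      · exact F.gen_pt_eq_zero rfl l
      · rfl) x l).trans (by split_ifs <;> rfl)
  have h1 : ∀ (u : F M S) (y : S), orbitRep y = y →
      ((F.beta M S (π u) : F M S) : Π₀ y : S, coeffAt M y) y =
        (u : Π₀ y : S, coeffAt M y) y := by
    intro u y hy
    induction u using PtFin.induction_on with
    | zero => simp
    | gen x l =>
      rw [hπ]
      split_ifs with hx
      · exact F.beta_gen_apply M hx hy l
      · rw [PtFin.gen_apply_ne fun (h : x = y) => hx (by rw [h, hy])]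
        simp
    | add u v hu hv =>
      rw [map_add, map_add, Submodule.coe_add, Submodule.coe_add, DFinsupp.add_apply, hu, hv,
        Submodule.coe_add, DFinsupp.add_apply]
  intro v
  refine ⟨π v, sub_eq_zero.1 ?_⟩
  have h2 : ∀ y : S, orbitRep y = y →
      (((F.beta M S (π v) - v : F.invariants M S) : F M S) : Π₀ y : S, coeffAt M y) y = 0 := by
    intro y hy
    rw [Submodule.coe_sub, Submodule.coe_sub, DFinsupp.sub_apply, h1 _ _ hy, sub_self]
  generalize F.beta M S (π v) - v = w at h2 ⊢
  refine Subtype.ext (Subtype.ext (DFinsupp.ext fun y => ?_))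
  obtain ⟨g, hg⟩ := exists_smul_eq_orbitRep y
  have hy : y = g⁻¹ • orbitRep y := by rw [← hg, inv_smul_smul]
  have h3 := F.act_apply_smul M g⁻¹ w.1 (orbitRep y)
  rw [h2 _ (orbitRep_orbitRep y), map_zero, w.2 g⁻¹, ← hy] at h3
  exact h3

theorem F.beta_map_congr {S T : PtGSet.{u} G} (f : S ⟶ T) {u v : F M S}
    (h : F.beta M S u = F.beta M S v) :
    F.beta M T (F.map M f u) = F.beta M T (F.map M f v) := by
  have := F.ker_beta_le M f (x := u - v) (LinearMap.mem_ker.2 (by rw [map_sub, h, sub_self]))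
  rw [LinearMap.mem_ker, LinearMap.comp_apply, map_sub, map_sub, sub_eq_zero] at this
  exact this

/-- The homomorphism `fᴳ_* : F(S, M)ᴳ → F(T, M)ᴳ` with `fᴳ_* ∘ β_S = β_T ∘ f_*`, that is,
`fᴳ_*(γᴳₓ(l)) = γᴳ_{f(x)}(M_*(f̂ₓ)(l))`; see `F.mapQuotient_beta` and `F.mapQuotient_gamma`. -/
noncomputable def F.mapQuotient {S T : PtGSet.{u} G} (f : S ⟶ T) :
    F.invariants M S →ₗ[R] F.invariants M T where
  toFun v := F.beta M T (F.map M f (Function.surjInv (F.beta_surjective M S) v))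
  map_add' v w := by
    rw [← map_add, ← map_add]
    refine F.beta_map_congr M f ?_
    rw [map_add, Function.surjInv_eq (F.beta_surjective M S), Function.surjInv_eq (F.beta_surjective M S),
      Function.surjInv_eq (F.beta_surjective M S)]
  map_smul' r v := by
    rw [RingHom.id_apply, ← map_smul, ← map_smul]
    refine F.beta_map_congr M f ?_
    rw [map_smul, Function.surjInv_eq (F.beta_surjective M S),
      Function.surjInv_eq (F.beta_surjective M S)]

theorem F.mapQuotient_beta {S T : PtGSet.{u} G} (f : S ⟶ T) (u : F M S) :
    F.mapQuotient M f (F.beta M S u) = F.beta M T (F.map M f u) :=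
  F.beta_map_congr M f (Function.surjInv_eq _ _)

theorem F.mapQuotient_gamma {S T : PtGSet.{u} G} (f : S ⟶ T) (x : S) (l : coeffAt M x) :
    (F.mapQuotient M f (F.beta M S (F.gen x l)) : F M T) =
      F.gamma M (f.toFun x) (M.map (OrbitCat.proj (PtGSet.stabilizer_le f x)) l) := by
  rw [F.mapQuotient_beta, F.map_gen, F.beta_gen]

/-- The functor `Fᴳ(-, M)`. -/
noncomputable def FQuotFunctor : PtGSet.{u} G ⥤ ModuleCat.{u} R where
  obj S := ModuleCat.of R (F.invariants M S)
  map f := ModuleCat.ofHom (F.mapQuotient M f)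
  map_id S := ModuleCat.hom_ext (LinearMap.ext fun v => by
    obtain ⟨u, rfl⟩ := F.beta_surjective M S v
    refine (F.mapQuotient_beta M _ u).trans ?_
    rw [F.map_id]
    rfl)
  map_comp {S T U} f g := ModuleCat.hom_ext (LinearMap.ext fun v => by
    obtain ⟨u, rfl⟩ := F.beta_surjective M S v
    refine (F.mapQuotient_beta M _ u).trans ?_
    rw [F.map_comp]
    exact ((congrArg _ (F.mapQuotient_beta M f u)).trans (F.mapQuotient_beta M g _)).symm)

/-- The epimorphism `β_S : F(S, M) → Fᴳ(S, M)`, as a natural transformation. -/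
noncomputable def betaNat : FFunctor M ⟶ FQuotFunctor M where
  app S := ModuleCat.ofHom (F.beta M S)
  naturality _ _ f := ModuleCat.hom_ext (LinearMap.ext fun u => (F.mapQuotient_beta M f u).symm)

end Coefficients

/-! ### k-spaces and pointed `G`-spaces -/

/-- The k-space `k(X)`: a set is closed if and only if its preimages under all continuous maps
from compact Hausdorff spaces to `X` are closed. -/
@[reducible]
def kTopology {X : Type v} (t : TopologicalSpace X) : TopologicalSpace X :=
  @TopologicalSpace.compactlyGenerated.{u} X t

/-- Topological abelian groups in the category of k-spaces: `A` is a k-space, the sum is continuous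
on the product `k(A × A)` of k-spaces, and `a ↦ -a` is continuous. -/
structure IsKTopologicalAddGroup (A : Type u) [TopologicalSpace A] [AddCommGroup A] : Prop where
  kspace : UCompactlyGeneratedSpace.{u} A
  continuous_add : @Continuous (A × A) A (kTopology.{u} inferInstance) inferInstance
    fun p => p.1 + p.2
  continuous_neg : Continuous fun a : A => -a

section Spaces

variable (G : Type w) [Group G]

/-- A pointed `G`-space in the category of k-spaces, with base point fixed by `G`. -/
structure PtGSpace extends PtGSet.{u} G where
  [top : TopologicalSpace carrier]
  kspace : UCompactlyGeneratedSpace.{u} carrier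
  continuous_smul : ∀ g : G, Continuous fun x : carrier => g • x

attribute [instance] PtGSpace.top

/-- Simplicial pointed `G`-sets. -/
abbrev SimplicialPtGSet : Type _ := SimplicialObject (PtGSet.{u} G)

variable {G}

namespace SimplicialPtGSet

/-- The simplicial set underlying a simplicial pointed `G`-set. -/
abbrev toSSet (Q : SimplicialPtGSet.{u} G) : SSet.{u} := Q ⋙ PtGSet.toType G

/-- The point `[x, t]` of `|Q|`. -/
def point {Q : SimplicialPtGSet.{u} G} {n : SimplexCategory} (x : Q.obj (op n))
    (t : TopSimplex n) : Realization (toSSet Q) :=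
  Realization.mk (X := toSSet Q) x t

/-- The action of `g` on the simplicial set underlying `Q`. -/
def actHom (Q : SimplicialPtGSet.{u} G) (g : G) : toSSet Q ⟶ toSSet Q where
  app n := ↾ fun x : Q.obj n => g • x
  naturality m n α := by
    ext x
    exact ((Q.map α).map_smul g x).symm

/-- The action of `G` on `|Q|`, `g [x, t] = [g x, t]`. -/
instance (Q : SimplicialPtGSet.{u} G) : MulAction G (Realization (toSSet Q)) where
  smul g := Realization.map (actHom Q g)
  one_smul p := by
    induction p using Realization.ind with | _ n x t => ?_
    exact congrArg (fun y : Q.obj (op n) => point y t)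
      (one_smul G (show (Q.obj (op n)).carrier from x))
  mul_smul g h p := by
    induction p using Realization.ind with | _ n x t => ?_
    exact congrArg (fun y : Q.obj (op n) => point y t)
      (mul_smul g h (show (Q.obj (op n)).carrier from x))

theorem smul_point {Q : SimplicialPtGSet.{u} G} (g : G) {n : SimplexCategory} (x : Q.obj (op n))
    (t : TopSimplex n) : g • point x t = point (g • x) t := rfl

/-- The pointed `G`-space `|Q|`. Its base point is `[x₀, ∗]`, where `x₀` is the base point of `Q₀`
and `∗` is the point of `Δ⁰`. -/
noncomputable def realize (Q : SimplicialPtGSet.{u} G) : PtGSpace.{u} G where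
  carrier := Realization (toSSet Q)
  pt := point (Q.obj (op (SimplexCategory.mk 0))).pt (stdSimplex.vertex 0)
  smul_pt g := congrArg (fun y => point y _) ((Q.obj _).smul_pt g)
  kspace := inferInstance
  continuous_smul g := Realization.continuous_map (actHom Q g)

/-- The point `[x, t]` of the pointed `G`-space `|Q|`. -/
def pointOf {Q : SimplicialPtGSet.{u} G} {n : SimplexCategory} (x : Q.obj (op n))
    (t : TopSimplex n) : (realize Q).toPtGSet := point x t

theorem point_pt {Q : SimplicialPtGSet.{u} G} {n : SimplexCategory} (t : TopSimplex n) :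
    pointOf (Q.obj (op n)).pt t = (realize Q).pt := by
  let α : n ⟶ SimplexCategory.mk 0 := SimplexCategory.const n (SimplexCategory.mk 0) 0
  have h := Realization.glue (X := toSSet Q) α (Q.obj (op (SimplexCategory.mk 0))).pt t
  have h1 : (toSSet Q).map α.op (Q.obj (op (SimplexCategory.mk 0))).pt = (Q.obj (op n)).pt :=
    (Q.map α.op).map_pt
  rw [h1] at h
  refine h.trans ?_
  exact congrArg (fun s => point (Q.obj (op (SimplexCategory.mk 0))).pt s)
    (Subsingleton.elim (α := stdSimplex ℝ (Fin 1)) _ _)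

/-- `Gₓ ⊆ G_{[x, t]}`. -/
theorem stabilizer_le_point {Q : SimplicialPtGSet.{u} G} {n : SimplexCategory} (x : Q.obj (op n))
    (t : TopSimplex n) :
    MulAction.stabilizer G x ≤ MulAction.stabilizer G (pointOf x t) := by
  intro g hg
  rw [MulAction.mem_stabilizer_iff] at hg ⊢
  exact congrArg (fun y => point y t) hg

/-- The pointed `G`-map `|f| : |Q| → |Q'|`, `[x, t] ↦ [f x, t]`. -/
noncomputable def realizeMap {Q Q' : SimplicialPtGSet.{u} G} (f : Q ⟶ Q') :
    (realize Q).toPtGSet ⟶ (realize Q').toPtGSet where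
  toFun := Realization.map (Functor.whiskerRight f (PtGSet.toType G))
  map_smul g p := by
    induction p using Realization.ind with | _ n x t => ?_
    exact congrArg (fun y : Q'.obj (op n) => point y t) ((f.app (op n)).map_smul g x)
  map_pt := congrArg (fun y => point y _) (f.app (op (SimplexCategory.mk 0))).map_pt

theorem realizeMap_pointOf {Q Q' : SimplicialPtGSet.{u} G} (f : Q ⟶ Q') {n : SimplexCategory}
    (x : Q.obj (op n)) (t : TopSimplex n) :
    (realizeMap f).toFun (pointOf x t) = pointOf ((f.app (op n)).toFun x) t := rfl

theorem continuous_realizeMap {Q Q' : SimplicialPtGSet.{u} G} (f : Q ⟶ Q') :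
    Continuous (X := (realize Q).carrier) (Y := (realize Q').carrier) (realizeMap f).toFun :=
  Realization.continuous_map _

end SimplicialPtGSet

/-- The subspace `X^H` of the elements of `X` that remain fixed under `H`. -/
abbrev FixedBy (X : PtGSpace.{u} G) (H : Subgroup G) : Type u :=
  {x : X.toPtGSet // ∀ h ∈ H, h • x = x}

/-- The base point of `X^H`. -/
def FixedBy.pt (X : PtGSpace.{u} G) (H : Subgroup G) : FixedBy X H :=
  ⟨X.pt, fun h _ => X.smul_pt h⟩

/-- `X^H` has the relative k-topology. -/
@[reducible]
def FixedBy.topology (X : PtGSpace.{u} G) (H : Subgroup G) : TopologicalSpace (FixedBy X H) :=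
  kTopology.{u} (X.top.induced Subtype.val)

theorem FixedBy.le_stabilizer {X : PtGSpace.{u} G} {H : Subgroup G} (x : FixedBy X H) :
    H ≤ MulAction.stabilizer G x.1 := fun h hh => x.2 h hh

end Spaces

/-! ### The topological groups `F(X, L)` for a module `L` -/

section ModuleCoefficients

variable (R : Type v) [CommRing R]

/-- `F(X, L)`: the module of functions `u : X → L` that vanish at the base point and almost
everywhere. -/
abbrev FMod {X : Type u} (pt : X) (L : Type u) [AddCommGroup L] [Module R L] : Type u :=
  PtFin R pt (fun _ : X => L)

/-- The map `μ_k : (L × X)ᵏ → F(X, L)`, `(l₁, x₁; …; l_k, x_k) ↦ l₁ x₁ + ⋯ + l_k x_k`. -/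
noncomputable def FMod.mu {X : Type u} (pt : X) (L : Type u) [AddCommGroup L] [Module R L] (k : ℕ)
    (z : Fin k → L × X) : FMod R pt L :=
  ∑ i, PtFin.gen (R := R) (pt := pt) (A := fun _ : X => L) (z i).2 (z i).1

/-- The topology of the product `(L × X)ᵏ` of k-spaces, where `L` is discrete. -/
@[reducible]
def FMod.powTopology (X : Type u) (tX : TopologicalSpace X) (L : Type u) (k : ℕ) :
    TopologicalSpace (Fin k → L × X) :=
  kTopology.{u} (@Pi.topologicalSpace (Fin k) (fun _ => L × X)
    fun _ => @instTopologicalSpaceProd L X ⊥ tX)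

/-- The identification topology on `F(X, L)` given by `∐_k (L × X)ᵏ → F(X, L)`. -/
@[reducible]
noncomputable def FMod.topology {X : Type u} (tX : TopologicalSpace X) (pt : X) (L : Type u)
    [AddCommGroup L] [Module R L] : TopologicalSpace (FMod R pt L) :=
  (@instTopologicalSpaceSigma ℕ (fun k => Fin k → L × X)
    fun k => FMod.powTopology X tX L k).coinduced fun z => FMod.mu R pt L z.1 z.2

end ModuleCoefficients

/-! ### The topological groups `𝔉(X, M)`, `𝔉̄ᴳ(X, M)` and `𝔉ᴳ(X, M)` -/

section TopologicalGroups

variable {G : Type w} [Group G] {R : Type v} [CommRing R] (M : OrbitCat G ⥤ ModuleCat.{u} R)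

/-- The homomorphism `p_H : F(X^H, M(G/H)) → F(X, M)`, `p_H(l x) = M_*(q_{H,x})(l) x`, where
`q_{H,x} : G/H → G/Gₓ` is the canonical projection. -/
noncomputable def pFixed (X : PtGSpace.{u} G) (H : Subgroup G) :
    FMod R (FixedBy.pt X H) (M.obj (OrbitCat.of H)) →ₗ[R] F M X.toPtGSet :=
  PtFin.lift fun x : FixedBy X H =>
    F.gen (S := X.toPtGSet) x.1 ∘ₗ (M.map (OrbitCat.proj (FixedBy.le_stabilizer x))).hom

variable [Finite G]

open scoped Classical in
/-- The homomorphism `p_X : ∏_H F(X^H, M(G/H)) → F(X, M)`, `(u_H)_H ↦ ∑_H p_H(u_H)`. -/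
noncomputable def pTotal (X : PtGSpace.{u} G) :
    (∀ H : Subgroup G, FMod R (FixedBy.pt X H) (M.obj (OrbitCat.of H))) →ₗ[R] F M X.toPtGSet :=
  letI := Fintype.ofFinite (Subgroup G)
  ∑ H : Subgroup G, pFixed M X H ∘ₗ LinearMap.proj H

/-- The topological group `𝔉(X, M)`: the group `F(X, M)` with the identification topology given by
`p_X`; see `EF.topology`. -/
def EF (X : PtGSpace.{u} G) : Type u := F M X.toPtGSet

/-- The topological group `𝔉̄ᴳ(X, M)`: the group `F(X, M)ᴳ` with the relative k-topology; see
`EFBar.topology`. -/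
def EFBar (X : PtGSpace.{u} G) : Type u := F.invariants M X.toPtGSet

/-- The topological group `𝔉ᴳ(X, M)`: the group `F(X, M)ᴳ` with the identification topology given
by `β_X`; see `EFQuot.topology`. -/
def EFQuot (X : PtGSpace.{u} G) : Type u := F.invariants M X.toPtGSet

variable (X : PtGSpace.{u} G)

noncomputable instance : AddCommGroup (EF M X) := inferInstanceAs (AddCommGroup (F M X.toPtGSet))

noncomputable instance : AddCommGroup (EFBar M X) :=
  inferInstanceAs (AddCommGroup (F.invariants M X.toPtGSet))

noncomputable instance : AddCommGroup (EFQuot M X) :=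
  inferInstanceAs (AddCommGroup (F.invariants M X.toPtGSet))

noncomputable instance EF.topology : TopologicalSpace (EF M X) :=
  (kTopology.{u} (@Pi.topologicalSpace (Subgroup G)
    (fun H => FMod R (FixedBy.pt X H) (M.obj (OrbitCat.of H)))
    fun H => FMod.topology R (FixedBy.topology X H) (FixedBy.pt X H)
      (M.obj (OrbitCat.of H)))).coinduced (pTotal M X)

/-- The inclusion `ι_X : 𝔉̄ᴳ(X, M) → 𝔉(X, M)`. -/
noncomputable def EF.iota : EFBar M X →+ EF M X :=
  (F.invariants M X.toPtGSet).subtype.toAddMonoidHom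

/-- The epimorphism `β_X : 𝔉(X, M) → 𝔉ᴳ(X, M)`. -/
noncomputable def EF.beta : EF M X →+ EFQuot M X :=
  (F.beta M X.toPtGSet).toAddMonoidHom

noncomputable instance EFBar.topology : TopologicalSpace (EFBar M X) :=
  kTopology.{u} ((EF.topology M X).induced (EF.iota M X))

noncomputable instance EFQuot.topology : TopologicalSpace (EFQuot M X) :=
  (EF.topology M X).coinduced (EF.beta M X)

variable {X} {Y : PtGSpace.{u} G}

/-- The generator `l x` of `𝔉(X, M)`. -/
noncomputable def EF.gen (x : X.toPtGSet) (l : coeffAt M x) : EF M X :=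
  F.gen (S := X.toPtGSet) x l

/-- The homomorphism `f_* : 𝔉(X, M) → 𝔉(Y, M)`. -/
noncomputable def EF.map (f : X.toPtGSet ⟶ Y.toPtGSet) : EF M X →+ EF M Y :=
  (F.map M f).toAddMonoidHom

/-- The homomorphism `f̄ᴳ_* : 𝔉̄ᴳ(X, M) → 𝔉̄ᴳ(Y, M)`. -/
noncomputable def EFBar.map (f : X.toPtGSet ⟶ Y.toPtGSet) : EFBar M X →+ EFBar M Y :=
  (F.mapInvariants M f).toAddMonoidHom

/-- The homomorphism `fᴳ_* : 𝔉ᴳ(X, M) → 𝔉ᴳ(Y, M)`. -/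
noncomputable def EFQuot.map (f : X.toPtGSet ⟶ Y.toPtGSet) : EFQuot M X →+ EFQuot M Y :=
  (F.mapQuotient M f).toAddMonoidHom

end TopologicalGroups

/-! ### The simplicial groups `F(Q, M)`, `F̄ᴳ(Q, M)` and `Fᴳ(Q, M)` -/

section SimplicialGroups

variable {G : Type w} [Group G] {R : Type v} [CommRing R] (M : OrbitCat G ⥤ ModuleCat.{u} R)

/-- The simplicial group `F(Q, M)`, with `F(Q, M)ₙ = F(Qₙ, M)`. -/
noncomputable abbrev SF (Q : SimplicialPtGSet.{u} G) : SimplicialObject (ModuleCat.{u} R) :=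
  Q ⋙ FFunctor M

/-- The simplicial subgroup `F̄ᴳ(Q, M)` of `F(Q, M)`. -/
noncomputable abbrev SFBar (Q : SimplicialPtGSet.{u} G) : SimplicialObject (ModuleCat.{u} R) :=
  Q ⋙ FBarFunctor M

/-- The generator `l x` of `F(Qₙ, M)`. -/
noncomputable def SF.gen {Q : SimplicialPtGSet.{u} G} {n : SimplexCategory} (x : Q.obj (op n))
    (l : coeffAt M x) : (SF M Q).obj (op n) :=
  F.gen (S := Q.obj (op n)) x l

/-- The inclusion `ι_Q : F̄ᴳ(Q, M) → F(Q, M)`. -/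
noncomputable abbrev SF.iota (Q : SimplicialPtGSet.{u} G) : SFBar M Q ⟶ SF M Q :=
  Functor.whiskerLeft Q (iotaNat M)

variable [Finite G]

/-- The simplicial quotient group `Fᴳ(Q, M)` of `F(Q, M)`. -/
noncomputable abbrev SFQuot (Q : SimplicialPtGSet.{u} G) : SimplicialObject (ModuleCat.{u} R) :=
  Q ⋙ FQuotFunctor M

/-- The epimorphism `β_Q : F(Q, M) → Fᴳ(Q, M)`. -/
noncomputable abbrev SF.beta (Q : SimplicialPtGSet.{u} G) : SF M Q ⟶ SFQuot M Q :=
  Functor.whiskerLeft Q (betaNat M)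

end SimplicialGroups

end DoldThom

open DoldThom DoldThom.SimplicialPtGSet

/-!
The isomorphism `Ψ_Q` is an instance of an assembly map. A functor `Φ` from pointed `G`-sets to
modules has a natural homomorphism `|Φ(Q)| → Φ(|Q|)` that takes `[a, t]` to the image of `a` under
the map induced by the pointed `G`-map `x ↦ [x, t]` (`assembly`). Naturality in `Q` and in `Φ` is
formal, and the latter gives the compatibility with `ι` and `β`.

Every point of a realization is `[x, t]` with `t` interior to its simplex, and `x ↦ [x, t]` is then
injective. The functors `F(-, M)`, `F̄ᴳ(-, M)` and `Fᴳ(-, M)` preserve injectivity: an injective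
`G`-map preserves isotropy groups, so that it commutes with `β` (`F.beta_map_of_injective`). Hence
the three assembly maps are injective, and since isotropy groups of interior points `[x, t]` and of
`x` agree, they are also surjective.

For the topology three facts are needed.
* The realization of a simplicial module is a topological group in k-spaces
  (`ModRealization.isKTopologicalAddGroup`). By Whitehead's theorem on products of a quotient map
  with a locally compact space, continuity on `|A| ×ₖ |A|` may be tested on products `Δᵐ × Δⁿ`
  (`Realization.continuous_of_mk_mk`), which are covered by finitely many simplices
  `(α_*, β_*) : Δᵏ → Δᵐ × Δⁿ` (`continuous_of_refinements`); on these the sum is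
  `u ↦ [α^* a + β^* b, u]`.
* An injective simplicial map realizes to a closed embedding (`Realization.isClosedEmbedding_map`).
  Therefore `|Q|^H` is the realization of `Q^H`, and `|F̄ᴳ(Q, M)|` carries the topology induced
  from `|F(Q, M)|`.
* On a simplex of `|F(Q, M)|` the map `Ψ_Q` is given by a finite formal sum with constant
  coefficients and continuously varying points (`IsContinuousSum`), which lifts to the space of
  formal sums that defines the topology of `𝔉(|Q|, M)`.

The second fact and the group structure of `|F(Q, M)|` make `Ψ_Q⁻¹` continuous: it suffices to
consider single terms `l x` with `x ∈ |Q|^H`, and `[x, t] ↦ [M_*(q)(l) x, t]` is continuous on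
`|Q^H|`. The statements for `F̄ᴳ` and `Fᴳ` follow, since their topologies are induced along `ι` and
coinduced along `β`. That the groups `𝔉`, `𝔉̄ᴳ`, `𝔉ᴳ` of `|Q|` are topological groups in k-spaces is
transported along the three isomorphisms.
-/

namespace DoldThom

/-! ### k-spaces -/

theorem kTopology_le {X : Type v} (t : TopologicalSpace X) : kTopology.{u} t ≤ t :=
  continuous_id_iff_le.1 (continuous_from_compactlyGenerated _ fun _ g => g.continuous)

theorem uCompactlyGeneratedSpace_kTopology {X : Type v} (t : TopologicalSpace X) :
    @UCompactlyGeneratedSpace.{u} X (kTopology.{u} t) := by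
  let f : (Σ i : (S : CompHaus.{u}) × C(S, X), i.fst) → X := fun p => p.1.2 p.2
  exact @uCompactlyGeneratedSpace_of_coinduced _ _ _ (kTopology.{u} t) inferInstance f
    (@continuous_coinduced_rng _ _ f _) rfl

/-- The universal property of the k-topology: a map from a k-space that is continuous for the
original topology is continuous for the k-topology. -/
theorem continuous_kTopology_rng {X : Type v} {Y : Type w} [TopologicalSpace Y]
    [UCompactlyGeneratedSpace.{u} Y] {t : TopologicalSpace X} {f : Y → X} (hf : Continuous f) :
    @Continuous Y X _ (kTopology.{u} t) f := by
  refine @continuous_from_uCompactlyGeneratedSpace _ _ _ (kTopology.{u} t) _ f fun S g => ?_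
  let c : (Σ i : (S : CompHaus.{u}) × C(S, X), i.fst) → X := fun p => p.1.2 p.2
  have h : @Continuous _ X _ (kTopology.{u} t) c := @continuous_coinduced_rng _ _ c _
  have h' : Continuous (Sigma.mk (β := fun i : (S : CompHaus.{u}) × C(S, X) => i.fst)
    ⟨S, ⟨f ∘ g, hf.comp g.continuous⟩⟩) := continuous_sigmaMk
  have h'' := @Continuous.comp _ _ _ _ _ (kTopology.{u} t) _ c h h'
  exact h''

theorem continuous_kTopology_dom {X : Type v} {Y : Type w} {t : TopologicalSpace X}
    [TopologicalSpace Y] {f : X → Y} (hf : Continuous f) :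
    @Continuous X Y (kTopology.{u} t) _ f :=
  continuous_le_dom (kTopology_le t) hf

namespace IsKTopologicalAddGroup

variable {A : Type u} [TopologicalSpace A] [AddCommGroup A]
  {Y : Type v} [TopologicalSpace Y] [UCompactlyGeneratedSpace.{u} Y]

theorem add (hA : IsKTopologicalAddGroup A) {f g : Y → A} (hf : Continuous f) (hg : Continuous g) :
    Continuous fun y => f y + g y := by
  have h := continuous_kTopology_rng (hf.prodMk hg)
  exact @Continuous.comp _ _ _ _ (kTopology.{u} inferInstance) _ _ _ hA.continuous_add h

theorem sum (hA : IsKTopologicalAddGroup A) {ι : Type*} (s : Finset ι) {f : ι → Y → A}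
    (hf : ∀ i, Continuous (f i)) :
    Continuous fun y => ∑ i ∈ s, f i y := by
  classical
  induction s using Finset.induction_on with
  | empty => simpa using continuous_const
  | insert i s hi ih => simpa [Finset.sum_insert hi] using hA.add (hf i) ih

/-- The structure of a topological group in k-spaces is transported along isomorphisms. -/
theorem of_equiv (hA : IsKTopologicalAddGroup A) {B : Type u} [TopologicalSpace B]
    [AddCommGroup B] (e : A ≃ₜ+ B) :
    IsKTopologicalAddGroup B where
  kspace := by
    have := hA.kspace
    exact uCompactlyGeneratedSpace_of_coinduced e.continuous
      e.toHomeomorph.isQuotientMap.eq_coinduced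
  continuous_add := by
    have := uCompactlyGeneratedSpace_kTopology.{u} (inferInstance : TopologicalSpace (B × B))
    let _ := kTopology.{u} (inferInstance : TopologicalSpace (B × B))
    have h1 : Continuous fun p : B × B => e.symm p.1 :=
      continuous_kTopology_dom (t := instTopologicalSpaceProd) (by fun_prop)
    have h2 : Continuous fun p : B × B => e.symm p.2 :=
      continuous_kTopology_dom (t := instTopologicalSpaceProd) (by fun_prop)
    refine (e.continuous.comp (hA.add h1 h2)).congr fun p => ?_
    exact (map_add e _ _).trans (congrArg₂ _ (e.apply_symm_apply _) (e.apply_symm_apply _))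
  continuous_neg := (e.continuous.comp (hA.continuous_neg.comp e.symm.continuous)).congr
    fun b => (map_neg e _).trans (congrArg _ (e.apply_symm_apply b))

end IsKTopologicalAddGroup

/-! ### Points of realizations and their interior representatives -/

theorem continuous_simplexMap {m n : SimplexCategory} (α : m ⟶ n) : Continuous (simplexMap α) :=
  stdSimplex.continuous_map _

instance finite_simplexCategory_hom (m n : SimplexCategory) : Finite (m ⟶ n) :=
  Finite.of_injective (fun α i => α.toOrderHom i : _ → Fin (m.len + 1) → Fin (n.len + 1))
    fun α β h => by ext i : 3; exact congrFun h i

/-- Every point of `Δⁿ` is an interior point of a face. -/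
theorem exists_mono_interior {n : SimplexCategory} (t : TopSimplex n) :
    ∃ (k : SimplexCategory) (u : TopSimplex k) (α : k ⟶ n), Mono α ∧ (∀ i, 0 < u i) ∧
      simplexMap α u = t := by
  obtain ⟨k, u, α, -, hu, h, -⟩ := exists_common_refinement t t
  refine ⟨Limits.image α, simplexMap (Limits.factorThruImage α) u, Limits.image.ι α, inferInstance,
    fun j => ?_, ?_⟩
  · obtain ⟨i, hi⟩ := SimplexCategory.epi_iff_surjective.1
      (inferInstance : Epi (Limits.factorThruImage α)) j
    rw [simplexMap_apply]
    exact Finset.sum_pos (fun i _ => hu i) ⟨i, by simpa using hi⟩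
  · rw [← simplexMap_comp, Limits.image.fac, h]

/-- A simplicial operator taking a point to an interior point is surjective on vertices, hence has
a section. -/
theorem exists_section_of_interior {k n : SimplexCategory} {α : k ⟶ n} {u : TopSimplex k}
    (h : ∀ j, 0 < simplexMap α u j) : ∃ σ : n ⟶ k, σ ≫ α = 𝟙 n := by
  have : Epi α := by
    refine SimplexCategory.epi_iff_surjective.2 fun j => ?_
    by_contra hj
    push Not at hj
    have h' := h j
    rw [simplexMap_apply, Finset.filter_false_of_mem fun i _ => hj i] at h'
    simp at h'
  have := isSplitEpi_of_epi α
  exact ⟨section_ α, IsSplitEpi.id α⟩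

namespace Realization

variable {X Y : SSet.{u}}

theorem isOpen_of_mk {s : Set (Realization X)}
    (h : ∀ (n : SimplexCategory) (x : X.obj (op n)), IsOpen {t : TopSimplex n | mk x t ∈ s}) :
    IsOpen s :=
  continuous_Prop.1 (continuous_of_mk (f := fun p => p ∈ s) fun n x => continuous_Prop.2 (h n x))

theorem map_section {k n : SimplexCategory} {α : k ⟶ n} {σ : n ⟶ k} (h : σ ≫ α = 𝟙 n)
    (x : X.obj (op n)) : X.map σ.op (X.map α.op x) = x := by
  have : X.map (σ ≫ α).op x = X.map σ.op (X.map α.op x) := by simp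
  rw [← this, h]
  simp

/-- Points with the same interior coordinates agree only if their simplices do. -/
theorem mk_injective_of_pos {n : SimplexCategory} {t : TopSimplex n} (ht : ∀ i, 0 < t i)
    {x y : X.obj (op n)} (h : mk x t = mk y t) : x = y := by
  obtain ⟨k, u, α, β, hu, h1, h2, h3⟩ := (mk_eq_mk_iff _ _ _ _).1 h
  obtain rfl : α = β := simplexMap_injective_of_pos hu (h1.trans h2.symm)
  obtain ⟨σ, hσ⟩ := exists_section_of_interior (α := α) (u := u) (by rw [h1]; exact ht)
  rw [← map_section hσ x, h3, map_section hσ]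

theorem exists_interior (p : Realization X) : ∃ (n : SimplexCategory) (x : X.obj (op n))
    (t : TopSimplex n), (∀ i, 0 < t i) ∧ p = mk x t := by
  induction p using ind with | _ n x t => ?_
  obtain ⟨k, u, α, -, hu, h⟩ := exists_mono_interior t
  exact ⟨k, X.map α.op x, u, hu, mk_refine x h⟩

theorem map_injective {f : X ⟶ Y} (hf : ∀ n, Function.Injective (f.app n)) :
    Function.Injective (map f) := by
  intro p q h
  obtain ⟨n, x, y, t, rfl, rfl⟩ := exists_common p q
  obtain ⟨k, u, α, -, hu, ht⟩ := exists_mono_interior t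
  rw [mk_refine x ht, mk_refine y ht] at h ⊢
  exact congrArg (fun z => mk z u) (hf _ (mk_injective_of_pos hu h))

/-- A simplicial map that is injective in each degree induces a closed embedding. The part of the
image of a closed set that lies in the simplex of `y` is the union, over the finitely many faces of
`y` that come from `X`, of the corresponding closed sets. -/
theorem isClosedEmbedding_map {f : X ⟶ Y} (hf : ∀ n, Function.Injective (f.app n)) :
    Topology.IsClosedEmbedding (map f) := by
  refine Topology.IsClosedEmbedding.of_continuous_injective_isClosedMap (continuous_map f)
    (map_injective hf) fun C hC => ?_
  have key : ∀ (n : SimplexCategory) (y : Y.obj (op n)),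
      IsClosed {t : TopSimplex n | mk y t ∈ map f '' C} := by
    intro n y
    have e : {t : TopSimplex n | mk y t ∈ map f '' C} =
        ⋃ k : Fin (n.len + 1), ⋃ α : SimplexCategory.mk (k : ℕ) ⟶ n,
          {t | ∃ x : X.obj (op (SimplexCategory.mk (k : ℕ))), f.app _ x = Y.map α.op y ∧
            ∃ s, mk x s ∈ C ∧ simplexMap α s = t} := by
      ext t
      simp only [Set.mem_ofPred_eq, Set.mem_iUnion]
      constructor
      · rintro ⟨p, hp, hpt⟩
        obtain ⟨l, x, s', hs', rfl⟩ := exists_interior p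
        obtain ⟨k, s, α, hα, hs, rfl⟩ := exists_mono_interior t
        rw [map_mk, ← glue] at hpt
        obtain ⟨j, v, γ, δ, hv, h1, h2, h3⟩ := (mk_eq_mk_iff _ _ _ _).1 hpt
        obtain ⟨σ, hσ⟩ := exists_section_of_interior (α := δ) (u := v) (by rw [h2]; exact hs)
        have h4 : f.app _ (X.map (σ ≫ γ).op x) = Y.map α.op y := by
          rw [NatTrans.naturality_apply f, op_comp, Functor.map_comp]
          exact (congrArg (Y.map σ.op) h3).trans (map_section hσ _)
        refine ⟨⟨k.len, Nat.lt_succ_of_le (SimplexCategory.len_le_of_mono α)⟩, α,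
          X.map (σ ≫ γ).op x, h4, s, ?_, rfl⟩
        refine (congrArg (· ∈ C) (map_injective hf ?_)).mp hp
        rw [map_mk, map_mk, h4, hpt]
      · rintro ⟨k, α, x, hx, s, hs, rfl⟩
        exact ⟨_, hs, by rw [map_mk, hx, glue]⟩
    rw [e]
    refine isClosed_iUnion_of_finite fun k => ?_
    refine isClosed_iUnion_of_finite fun α => ?_
    by_cases hx : ∃ x : X.obj (op (SimplexCategory.mk (k : ℕ))), f.app _ x = Y.map α.op y
    · obtain ⟨x, hx⟩ := hx
      have hc : IsCompact (simplexMap α '' {s | mk x s ∈ C}) :=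
        ((hC.preimage (continuous_mk x)).isCompact).image (continuous_simplexMap α)
      convert hc.isClosed using 1
      ext t
      constructor
      · rintro ⟨x', hx', s, hs, rfl⟩
        obtain rfl := hf _ (hx'.trans hx.symm)
        exact ⟨s, hs, rfl⟩
      · rintro ⟨s, hs, rfl⟩
        exact ⟨x, hx, s, hs, rfl⟩
    · convert isClosed_empty
      rw [Set.eq_empty_iff_forall_notMem]
      rintro t ⟨x, h, -⟩
      exact hx ⟨x, h⟩
  exact isOpen_compl_iff.1 (isOpen_of_mk fun n y => (key n y).isOpen_compl)

/-! ### Products of realizations -/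

/-- The characteristic maps of the simplices combine to a quotient map onto `|X|`. -/
theorem isQuotientMap_sigma (X : SSet.{u}) :
    Topology.IsQuotientMap (fun p : Σ i : (Σ n : SimplexCategory, X.obj (op n)), TopSimplex i.1 =>
      mk p.1.2 p.2) := by
  have hc : Continuous (fun p : Σ i : (Σ n : SimplexCategory, X.obj (op n)), TopSimplex i.1 =>
      mk p.1.2 p.2) := continuous_sigma fun i => continuous_mk i.2
  refine (Topology.isQuotientMap_iff _).2 ⟨Topology.IsCoinducing.of_isOpen_preimage_iff_isOpen
    fun s => ⟨fun hs => isOpen_of_mk fun n x => ?_, fun hs => hs.preimage hc⟩, fun p => ?_⟩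
  swap
  · induction p using ind with | _ n x t => ?_
    exact ⟨⟨⟨n, x⟩, t⟩, rfl⟩
  · exact isOpen_sigma_iff.1 hs ⟨n, x⟩

/-- Continuity of a map out of `|X| × W`, for `W` locally compact, may be tested on simplices. -/
theorem continuous_of_mk_prod {W Z : Type*} [TopologicalSpace W] [LocallyCompactSpace W]
    [TopologicalSpace Z] {h : Realization X × W → Z}
    (hh : ∀ (n : SimplexCategory) (x : X.obj (op n)),
      Continuous fun p : TopSimplex n × W => h (mk x p.1, p.2)) : Continuous h := by
  refine (isQuotientMap_sigma X).continuous_lift_prod_left ?_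
  have : Continuous fun q : Σ i : (Σ n : SimplexCategory, X.obj (op n)), TopSimplex i.1 × W =>
      h (mk q.1.2 q.2.1, q.2.2) := continuous_sigma fun i => hh i.1 i.2
  exact this.comp (Homeomorph.sigmaProdDistrib
    (X := fun i : (Σ n : SimplexCategory, X.obj (op n)) => TopSimplex i.1) (Y := W)).continuous

/-- Continuity of a map out of the product of k-spaces `|X| × |Y|` may be tested on products of
simplices. -/
theorem continuous_of_mk_mk {Z : Type*} [TopologicalSpace Z] {h : Realization X × Realization Y → Z}
    (hh : ∀ (m n : SimplexCategory) (x : X.obj (op m)) (y : Y.obj (op n)),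
      Continuous fun p : TopSimplex m × TopSimplex n => h (mk x p.1, mk y p.2)) :
    @Continuous _ _ (kTopology.{u} instTopologicalSpaceProd) _ h := by
  refine continuous_from_compactlyGenerated _ fun K g => ?_
  have lc : ∀ (K : Type u) [TopologicalSpace K] [CompactSpace K] [T2Space K],
      LocallyCompactSpace K := fun K _ _ _ => inferInstance
  have := lc K
  have h1 : ∀ (m : SimplexCategory) (x : X.obj (op m)),
      Continuous fun p : Realization Y × TopSimplex m => h (mk x p.2, p.1) := fun m x =>
    continuous_of_mk_prod fun n y => (hh m n x y).comp continuous_swap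
  have h2 : Continuous fun p : Realization X × K => h (p.1, (g p.2).2) :=
    continuous_of_mk_prod fun m x => (h1 m x).comp
      (((continuous_snd.comp g.continuous).comp continuous_snd).prodMk continuous_fst)
  exact h2.comp ((continuous_fst.comp g.continuous).prodMk continuous_id)

end Realization

/-! ### Addition on the realization of a simplicial module -/

/-- Two points of simplices have a common refinement of bounded dimension. The bound comes from the
factorization of `(α, β) : [k] → [m] × [n]`, with `[m] × [n]` ordered lexicographically, through its
image. -/
theorem exists_bounded_refinement {m n : SimplexCategory} (s : TopSimplex m) (t : TopSimplex n) :
    ∃ (k : SimplexCategory) (u : TopSimplex k) (α : k ⟶ m) (β : k ⟶ n),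
      k.len ≤ (m.len + 1) * (n.len + 1) ∧ simplexMap α u = s ∧ simplexMap β u = t := by
  obtain ⟨k, u, α, β, -, hs, ht⟩ := exists_common_refinement s t
  let f : Fin (k.len + 1) → Fin ((m.len + 1) * (n.len + 1)) := fun i =>
    finProdFinEquiv (α.toOrderHom i, β.toOrderHom i)
  let φ : k ⟶ SimplexCategory.mk ((m.len + 1) * (n.len + 1)) :=
    SimplexCategory.Hom.mk ⟨fun i => (f i).castSucc, fun i j hij => by
      have h1 : (α.toOrderHom i : ℕ) ≤ α.toOrderHom j := α.toOrderHom.monotone hij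
      have h2 : (β.toOrderHom i : ℕ) ≤ β.toOrderHom j := β.toOrderHom.monotone hij
      exact Nat.add_le_add h2 (Nat.mul_le_mul_left _ h1)⟩
  let e := Limits.factorThruImage φ
  have hφ : e ≫ Limits.image.ι φ = φ := Limits.image.fac φ
  have := isSplitEpi_of_epi e
  have h : ∀ i, f ((section_ e).toOrderHom (e.toOrderHom i)) = f i := by
    have h1 : e ≫ section_ e ≫ φ = φ :=
      (congrArg (fun ψ => e ≫ section_ e ≫ ψ) hφ.symm).trans
        ((congrArg (e ≫ ·) (IsSplitEpi.id_assoc e _)).trans hφ)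
    intro i
    have h2 := DFunLike.congr_fun (congrArg SimplexCategory.Hom.toOrderHom h1) i
    exact Fin.castSucc_injective _ h2
  have hα : e ≫ section_ e ≫ α = α := by
    ext i : 3
    exact congrArg Prod.fst (finProdFinEquiv.injective (h i))
  have hβ : e ≫ section_ e ≫ β = β := by
    ext i : 3
    exact congrArg Prod.snd (finProdFinEquiv.injective (h i))
  refine ⟨_, simplexMap e u, section_ e ≫ α, section_ e ≫ β,
    SimplexCategory.len_le_of_mono (Limits.image.ι φ), ?_, ?_⟩
  · rw [← simplexMap_comp, hα, hs]
  · rw [← simplexMap_comp, hβ, ht]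

/-- Continuity on `Δᵐ × Δⁿ` may be tested along the maps `(α_*, β_*) : Δᵏ → Δᵐ × Δⁿ`: finitely many
of them cover this compact Hausdorff space. -/
theorem continuous_of_refinements {m n : SimplexCategory} {Z : Type*} [TopologicalSpace Z]
    {h : TopSimplex m × TopSimplex n → Z}
    (hh : ∀ (k : SimplexCategory) (α : k ⟶ m) (β : k ⟶ n),
      Continuous fun u : TopSimplex k => h (simplexMap α u, simplexMap β u)) : Continuous h := by
  obtain ⟨N, hN⟩ : ∃ N : ℕ, ∀ (s : TopSimplex m) (t : TopSimplex n),
      ∃ (k : SimplexCategory) (u : TopSimplex k) (α : k ⟶ m) (β : k ⟶ n),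
        k.len ≤ N ∧ simplexMap α u = s ∧ simplexMap β u = t := ⟨_, exists_bounded_refinement⟩
  let I := Σ k : Fin (N + 1),
    (SimplexCategory.mk (k : ℕ) ⟶ m) × (SimplexCategory.mk (k : ℕ) ⟶ n)
  let q : (Σ i : I, TopSimplex (SimplexCategory.mk (i.1 : ℕ))) → TopSimplex m × TopSimplex n :=
    fun p => (simplexMap p.1.2.1 p.2, simplexMap p.1.2.2 p.2)
  have hq : Continuous q := continuous_sigma fun i =>
    (continuous_simplexMap i.2.1).prodMk (continuous_simplexMap i.2.2)
  have hs : Function.Surjective q := by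
    rintro ⟨s, t⟩
    obtain ⟨k, u, α, β, hk, rfl, rfl⟩ := hN s t
    let i : I := ⟨⟨k.len, Nat.lt_succ_of_le hk⟩, α, β⟩
    exact ⟨⟨i, u⟩, rfl⟩
  refine (hq.isClosedMap.isQuotientMap hq hs).continuous_iff.2 ?_
  have hi : ∀ i : I, Continuous fun u : TopSimplex (SimplexCategory.mk (i.1 : ℕ)) =>
      h (simplexMap i.2.1 u, simplexMap i.2.2 u) := fun i => hh _ i.2.1 i.2.2
  exact continuous_sigma hi

namespace ModRealization

variable {R : Type v} [CommRing R] {A B : SimplicialObject (ModuleCat.{u} R)}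

theorem continuous_mk {n : SimplexCategory} (a : A.obj (op n)) :
    Continuous (mk a : TopSimplex n → ModRealization A) :=
  Realization.continuous_mk (X := underlying A) a

theorem continuous_of_mk {Y : Type*} [TopologicalSpace Y] {f : ModRealization A → Y}
    (h : ∀ (n : SimplexCategory) (a : A.obj (op n)),
      Continuous fun t : TopSimplex n => f (mk a t)) :
    Continuous f :=
  Realization.continuous_of_mk (X := underlying A) h

theorem continuous_map (f : A ⟶ B) : Continuous (map f) :=
  Realization.continuous_map _

theorem isClosedEmbedding_map {f : A ⟶ B} (hf : ∀ n, Function.Injective (f.app n)) :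
    Topology.IsClosedEmbedding (map f) :=
  Realization.isClosedEmbedding_map (f := Functor.whiskerRight f (forget (ModuleCat.{u} R))) hf

theorem exists_interior (p : ModRealization A) : ∃ (n : SimplexCategory) (a : A.obj (op n))
    (t : TopSimplex n), (∀ i, 0 < t i) ∧ p = mk a t :=
  Realization.exists_interior (X := underlying A) p

/-- The realization of a simplicial module is a topological group in the category of k-spaces: on
a common refinement of two simplices the sum is `u ↦ [α^* a + β^* b, u]`. -/
theorem isKTopologicalAddGroup (A : SimplicialObject (ModuleCat.{u} R)) :
    IsKTopologicalAddGroup (ModRealization A) where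
  kspace := inferInstanceAs (UCompactlyGeneratedSpace.{u} (Realization (underlying A)))
  continuous_add := by
    refine Realization.continuous_of_mk_mk (X := underlying A) (Y := underlying A)
      (h := fun p : ModRealization A × ModRealization A => p.1 + p.2) fun m n a b => ?_
    refine continuous_of_refinements fun k α β => ?_
    refine (continuous_mk (A := A) (A.map α.op a + A.map β.op b)).congr fun u => ?_
    rw [← mk_add_mk, glue, glue]
    rfl
  continuous_neg := continuous_map _

end ModRealization

/-! ### Injective maps of pointed `G`-sets -/

section InjectiveMaps

variable {G : Type w} [Group G] {R : Type v} [CommRing R]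

theorem OrbitCat.proj_comp {H K L : Subgroup G} (h : H ≤ K) (h' : K ≤ L) :
    OrbitCat.proj h ≫ OrbitCat.proj h' = OrbitCat.proj (h.trans h') :=
  OrbitCat.hom_ext fun a => congrArg QuotientGroup.mk (by simp)

variable (M : OrbitCat G ⥤ ModuleCat.{u} R)

theorem map_proj_map_proj {H K L : Subgroup G} (h : H ≤ K) (h' : K ≤ L) (l : M.obj (.of H)) :
    M.map (OrbitCat.proj h') (M.map (OrbitCat.proj h) l) =
      M.map (OrbitCat.proj (h.trans h')) l := by
  rw [← OrbitCat.proj_comp h h', M.map_comp, ModuleCat.comp_apply]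

theorem map_proj_refl {H : Subgroup G} (h : H ≤ H) (l : M.obj (.of H)) :
    M.map (OrbitCat.proj h) l = l := by
  rw [OrbitCat.proj_refl, M.map_id, ModuleCat.id_apply]

theorem PtGSet.stabilizer_eq_of_injective {S T : PtGSet.{u} G} {f : S ⟶ T}
    (hf : Function.Injective f.toFun) (x : S) :
    MulAction.stabilizer G (f.toFun x) = MulAction.stabilizer G x := by
  refine le_antisymm (fun g hg => ?_) (PtGSet.stabilizer_le f x)
  rw [MulAction.mem_stabilizer_iff] at hg ⊢
  exact hf ((f.map_smul g x).trans hg)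

theorem F.map_apply_of_injective {S T : PtGSet.{u} G} {f : S ⟶ T}
    (hf : Function.Injective f.toFun) (u : F M S) (x : S) :
    (F.map M f u : Π₀ y : T, coeffAt M y) (f.toFun x) =
      M.map (OrbitCat.proj (PtGSet.stabilizer_le f x)) ((u : Π₀ y : S, coeffAt M y) x) := by
  by_cases hx : x = S.pt
  · have h1 : ∀ (v : F M T) (y : T), y = T.pt → (v : Π₀ y : T, coeffAt M y) y = 0 := by
      rintro v y rfl
      exact PtFin.apply_pt v
    rw [h1 _ _ (by rw [hx, f.map_pt])]
    subst hx
    rw [PtFin.apply_pt u, map_zero]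
  · have hfx : f.toFun x ≠ T.pt := fun h => hx (hf (h.trans f.map_pt.symm))
    induction u using PtFin.induction_on with
    | zero => simp
    | gen z l =>
      rw [F.map_gen]
      by_cases hz : z = x
      · subst hz
        rw [PtFin.gen_apply_self hfx, PtFin.gen_apply_self hx]
      · rw [PtFin.gen_apply_ne hz, map_zero, PtFin.gen_apply_ne fun h => hz (hf h)]
    | add u v hu hv =>
      rw [map_add, Submodule.coe_add, DFinsupp.add_apply, hu, hv, Submodule.coe_add,
        DFinsupp.add_apply, map_add]

theorem F.map_injective {S T : PtGSet.{u} G} {f : S ⟶ T} (hf : Function.Injective f.toFun) :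
    Function.Injective (F.map M f) := by
  refine (injective_iff_map_eq_zero _).2 fun u hu => Subtype.ext (DFinsupp.ext fun x => ?_)
  have h := F.map_apply_of_injective M hf u x
  rw [hu] at h
  have h' := map_proj_map_proj M (PtGSet.stabilizer_le f x)
    (PtGSet.stabilizer_eq_of_injective hf x).le ((u : Π₀ y : S, coeffAt M y) x)
  rw [← h, map_proj_refl] at h'
  exact h'.symm.trans (map_zero _)

theorem F.mapInvariants_injective {S T : PtGSet.{u} G} {f : S ⟶ T}
    (hf : Function.Injective f.toFun) : Function.Injective (F.mapInvariants M f) :=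
  fun _ _ h => Subtype.ext (F.map_injective M hf (congrArg Subtype.val h))

variable [Finite G]

/-- For an injective `G`-map `f` the isotropy groups of `x` and `f x` agree, so that `f_*` commutes
with `β`. -/
theorem F.beta_map_of_injective {S T : PtGSet.{u} G} {f : S ⟶ T}
    (hf : Function.Injective f.toFun) (u : F M S) :
    (F.beta M T (F.map M f u) : F M T) = F.map M f (F.beta M S u : F M S) := by
  have aux : ∀ {H K : Subgroup G} (_ : H = K) [Fintype (G ⧸ H)] [Fintype (G ⧸ K)]
      (φ : G → F M T), ∑ q : G ⧸ H, φ q.out = ∑ q : G ⧸ K, φ q.out := by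
    rintro H _ rfl i j φ
    obtain rfl := Subsingleton.elim i j
    rfl
  suffices (F.invariants M T).subtype ∘ₗ F.beta M T ∘ₗ F.map M f =
      F.map M f ∘ₗ (F.invariants M S).subtype ∘ₗ F.beta M S from LinearMap.congr_fun this u
  refine PtFin.hom_ext fun x l => ?_
  change (F.beta M T (F.map M f (F.gen x l)) : F M T) =
    F.map M f (F.beta M S (F.gen x l) : F M S)
  let _ := Fintype.ofFinite (G ⧸ MulAction.stabilizer G x)
  let _ := Fintype.ofFinite (G ⧸ MulAction.stabilizer G (f.toFun x))
  rw [F.map_gen, F.beta_gen, F.beta_gen, F.gamma_apply, F.gamma_apply, map_sum, ← F.map_gen,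
    aux (PtGSet.stabilizer_eq_of_injective hf x) fun g => F.act M T g (F.map M f (F.gen x l))]
  exact Finset.sum_congr rfl fun q _ => (F.map_act M f _ _).symm

theorem F.mapQuotient_injective {S T : PtGSet.{u} G} {f : S ⟶ T}
    (hf : Function.Injective f.toFun) : Function.Injective (F.mapQuotient M f) := by
  refine (injective_iff_map_eq_zero _).2 fun v hv => ?_
  obtain ⟨u, rfl⟩ := F.beta_surjective M S v
  rw [F.mapQuotient_beta] at hv
  refine Subtype.ext (F.map_injective M hf ?_)
  rw [← F.beta_map_of_injective M hf, hv]
  exact (map_zero _).symm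

end InjectiveMaps

/-! ### The assembly map -/

section Assembly

variable {G : Type w} [Group G] {R : Type v} [CommRing R]

/-- The pointed `G`-map `Qₙ → |Q|`, `x ↦ [x, t]`. -/
noncomputable def pointMap (Q : SimplicialPtGSet.{u} G) {n : SimplexCategory} (t : TopSimplex n) :
    Q.obj (op n) ⟶ (realize Q).toPtGSet where
  toFun x := pointOf x t
  map_smul _ _ := rfl
  map_pt := point_pt t

theorem map_comp_pointMap (Q : SimplicialPtGSet.{u} G) {m n : SimplexCategory} (α : m ⟶ n)
    (t : TopSimplex m) : Q.map α.op ≫ pointMap Q t = pointMap Q (simplexMap α t) :=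
  PtGSet.Hom.ext (funext fun x => Realization.glue (X := toSSet Q) α x t)

theorem pointMap_comp_realizeMap {Q Q' : SimplicialPtGSet.{u} G} (f : Q ⟶ Q')
    {n : SimplexCategory} (t : TopSimplex n) :
    pointMap Q t ≫ realizeMap f = f.app (op n) ≫ pointMap Q' t := rfl

theorem pointMap_injective (Q : SimplicialPtGSet.{u} G) {n : SimplexCategory} {t : TopSimplex n}
    (ht : ∀ i, 0 < t i) : Function.Injective (pointMap Q t).toFun :=
  fun _ _ h => Realization.mk_injective_of_pos (X := toSSet Q) ht h

variable (Φ : PtGSet.{u} G ⥤ ModuleCat.{u} R) (Q : SimplicialPtGSet.{u} G)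

/-- The assembly map `|Φ(Q)| → Φ(|Q|)` of a functor `Φ` from pointed `G`-sets to modules: it takes
`[a, t]` to the image of `a ∈ Φ(Qₙ)` under the map induced by `x ↦ [x, t]`. -/
noncomputable def assembly :
    ModRealization (Q ⋙ Φ) →+ Φ.obj (realize Q).toPtGSet :=
  AddMonoidHom.mk'
    (Quot.lift (fun p => Φ.map (pointMap Q p.2.2) (p.2.1 : Φ.obj (Q.obj (op p.1)))) (by
      rintro _ _ ⟨α, a, t⟩
      change Φ.map (pointMap Q t) (Φ.map (Q.map α.op) a) = Φ.map (pointMap Q (simplexMap α t)) a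
      rw [← ModuleCat.comp_apply, ← Φ.map_comp, map_comp_pointMap]))
    (fun p q => by
      obtain ⟨n, a, b, t, rfl, rfl⟩ := ModRealization.exists_common p q
      rw [ModRealization.mk_add_mk]
      exact map_add (Φ.map (pointMap Q t)).hom a b)

variable {Φ Q}

theorem assembly_map {Q' : SimplicialPtGSet.{u} G} (f : Q ⟶ Q') (p : ModRealization (Q ⋙ Φ)) :
    assembly Φ Q' (ModRealization.map (Functor.whiskerRight f Φ) p) =
      Φ.map (realizeMap f) (assembly Φ Q p) := by
  induction p using ModRealization.ind with | _ n a t => ?_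
  change Φ.map (pointMap Q' t) (Φ.map (f.app (op n)) a) =
    Φ.map (realizeMap f) (Φ.map (pointMap Q t) a)
  rw [← ModuleCat.comp_apply, ← ModuleCat.comp_apply, ← Φ.map_comp, ← Φ.map_comp,
    pointMap_comp_realizeMap]

theorem assembly_natTrans {Φ' : PtGSet.{u} G ⥤ ModuleCat.{u} R} (η : Φ ⟶ Φ')
    (p : ModRealization (Q ⋙ Φ)) :
    assembly Φ' Q (ModRealization.map (Functor.whiskerLeft Q η) p) =
      η.app _ (assembly Φ Q p) := by
  induction p using ModRealization.ind with | _ n a t => ?_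
  exact (NatTrans.naturality_apply η (pointMap Q t) a).symm

/-- Since every point of `|Φ(Q)|` is `[a, t]` with `t` an interior point, for which `x ↦ [x, t]` is
injective, the assembly map is injective whenever `Φ` preserves injectivity. -/
theorem assembly_injective
    (hΦ : ∀ {S T : PtGSet.{u} G} (f : S ⟶ T), Function.Injective f.toFun →
      Function.Injective (Φ.map f)) : Function.Injective (assembly Φ Q) := by
  refine (injective_iff_map_eq_zero _).2 fun p hp => ?_
  obtain ⟨n, a, t, ht, rfl⟩ := ModRealization.exists_interior p
  have h : a = 0 := hΦ _ (pointMap_injective Q ht) (hp.trans (map_zero _).symm)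
  rw [h, ModRealization.mk_zero]

end Assembly

/-! ### Bijectivity of the assembly maps -/

section Bijective

variable {G : Type w} [Group G] {R : Type v} [CommRing R] (M : OrbitCat G ⥤ ModuleCat.{u} R)
  (Q : SimplicialPtGSet.{u} G)

theorem assembly_F_gen {n : SimplexCategory} (x : Q.obj (op n)) (l : coeffAt M x)
    (t : TopSimplex n) : assembly (FFunctor M) Q (ModRealization.mk (SF.gen M x l) t) =
      EF.gen M (pointOf x t) (M.map (OrbitCat.proj (stabilizer_le_point x t)) l) :=
  F.map_gen M (pointMap Q t) x l

theorem assembly_F_bijective : Function.Bijective (assembly (FFunctor M) Q) := by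
  refine ⟨assembly_injective fun f hf => F.map_injective M hf, fun v => ?_⟩
  change F M (realize Q).toPtGSet at v
  induction v using PtFin.induction_on with
  | zero => exact ⟨0, map_zero _⟩
  | gen p l =>
    obtain ⟨n, x, t, ht, rfl⟩ := Realization.exists_interior (X := toSSet Q) p
    refine ⟨ModRealization.mk (SF.gen M (Q := Q) x (M.map (OrbitCat.proj
      (PtGSet.stabilizer_eq_of_injective (pointMap_injective Q ht) x).le) l)) t, ?_⟩
    refine (assembly_F_gen M Q _ _ _).trans ?_
    exact congrArg (F.gen (pointOf x t)) ((map_proj_map_proj M _ _ l).trans (map_proj_refl M _ l))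
  | add v v' hv hv' =>
    obtain ⟨p, rfl⟩ := hv
    obtain ⟨p', rfl⟩ := hv'
    exact ⟨p + p', map_add _ _ _⟩

theorem assembly_FBar_bijective : Function.Bijective (assembly (FBarFunctor M) Q) := by
  refine ⟨assembly_injective fun f hf => F.mapInvariants_injective M hf, fun v => ?_⟩
  obtain ⟨p, hp⟩ := (assembly_F_bijective M Q).2 (v : F.invariants M (realize Q).toPtGSet).1
  obtain ⟨n, a, t, ht, rfl⟩ := ModRealization.exists_interior p
  change F.map M (pointMap Q t) a = _ at hp
  refine ⟨ModRealization.mk (A := SFBar M Q)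
    (⟨a, fun g => F.map_injective M (pointMap_injective Q ht) ?_⟩ :
      F.invariants M (Q.obj (op n))) t, Subtype.ext hp⟩
  refine (F.map_act M (pointMap Q t) g a).trans ?_
  exact (congrArg _ hp).trans ((v.2 g).trans hp.symm)

variable [Finite G]

theorem assembly_FQuot_bijective : Function.Bijective (assembly (FQuotFunctor M) Q) := by
  refine ⟨assembly_injective fun f hf => F.mapQuotient_injective M hf, fun v => ?_⟩
  obtain ⟨w, rfl⟩ := F.beta_surjective M (realize Q).toPtGSet v
  obtain ⟨p, rfl⟩ := (assembly_F_bijective M Q).2 w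
  exact ⟨_, assembly_natTrans (betaNat M) p⟩

end Bijective

/-! ### Continuity of the assembly map of `F(-, M)` -/

section Continuity

variable {G : Type w} [Group G] {R : Type v} [CommRing R] (M : OrbitCat G ⥤ ModuleCat.{u} R)

theorem pFixed_gen (X : PtGSpace.{u} G) (H : Subgroup G) (x : FixedBy X H) (l : M.obj (.of H)) :
    pFixed M X H (PtFin.gen x l) =
      F.gen (S := X.toPtGSet) x.1 (M.map (OrbitCat.proj (FixedBy.le_stabilizer x)) l) :=
  PtFin.lift_gen (fun x : FixedBy X H => F.gen (S := X.toPtGSet) x.1 ∘ₗ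
    (M.map (OrbitCat.proj (FixedBy.le_stabilizer x))).hom) (fun _ => F.gen_pt_eq_zero rfl _) x l

variable [Finite G]

theorem pTotal_apply [Fintype (Subgroup G)] (X : PtGSpace.{u} G)
    (z : ∀ H : Subgroup G, FMod R (FixedBy.pt X H) (M.obj (OrbitCat.of H))) :
    pTotal M X z = ∑ H : Subgroup G, pFixed M X H (z H) := by
  unfold pTotal
  rw [LinearMap.sum_apply]
  exact Finset.sum_congr (by congr!) fun H _ => rfl

/-- A family `φ` of elements of `𝔉(X, M)`, depending on a parameter, is a continuous formal sum if
it is of the form `∑_H p_H(∑ᵢ l_{H,i} x_{H,i}(t))` with finitely many constant coefficients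
`l_{H,i} ∈ M(G/H)` and continuous functions `x_{H,i}` with values in `X^H`. -/
def IsContinuousSum {T : Type*} [TopologicalSpace T] {X : PtGSpace.{u} G} (φ : T → EF M X) :
    Prop :=
  ∃ (k : Subgroup G → ℕ) (l : ∀ H, Fin (k H) → M.obj (OrbitCat.of H))
    (x : ∀ H, Fin (k H) → T → FixedBy X H),
    (∀ H i, @Continuous _ _ _ (FixedBy.topology X H) (x H i)) ∧
      ∀ t, φ t = pTotal M X fun H => FMod.mu R (FixedBy.pt X H) (M.obj (OrbitCat.of H)) (k H)
        fun i => (l H i, x H i t)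

variable {M}

namespace IsContinuousSum

variable {T : Type*} [TopologicalSpace T] {X : PtGSpace.{u} G} {φ ψ : T → EF M X}

theorem zero : IsContinuousSum M (fun _ : T => (0 : EF M X)) := by
  refine ⟨fun _ => 0, fun _ => Fin.elim0, fun _ => Fin.elim0, fun _ i => i.elim0, fun t => ?_⟩
  refine ((congrArg (pTotal M X) (funext fun H => ?_)).trans (map_zero (pTotal M X))).symm
  exact Finset.sum_empty

theorem add (hφ : IsContinuousSum M φ) (hψ : IsContinuousSum M ψ) :
    IsContinuousSum M fun t => φ t + ψ t := by
  obtain ⟨k, l, x, hx, h⟩ := hφ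
  obtain ⟨k', l', x', hx', h'⟩ := hψ
  refine ⟨fun H => k H + k' H, fun H => Fin.append (l H) (l' H), fun H => Fin.append (x H) (x' H),
    fun H i => ?_, fun t => ?_⟩
  · refine Fin.addCases (fun i => ?_) (fun i => ?_) i <;> dsimp only
    · rw [Fin.append_left]; exact hx H i
    · rw [Fin.append_right]; exact hx' H i
  · refine (congrArg₂ _ (h t) (h' t)).trans ?_
    refine (map_add (pTotal M X) _ _).symm.trans (congrArg _ (funext fun H => ?_))
    simp only [Pi.add_apply, FMod.mu, Fin.sum_univ_add, Fin.append_left, Fin.append_right]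

theorem single {H : Subgroup G} {x : T → FixedBy X H}
    (hx : @Continuous _ _ _ (FixedBy.topology X H) x) (l : M.obj (OrbitCat.of H))
    (h : ∀ t, φ t = pFixed M X H (PtFin.gen (x t) l)) : IsContinuousSum M φ := by
  classical
  let _ := Fintype.ofFinite (Subgroup G)
  refine ⟨fun _ => 1, fun H' _ => Pi.single (M := fun H => M.obj (OrbitCat.of H)) H l H',
    fun H' _ => Function.update (fun H' _ => FixedBy.pt X H') H x H', fun H' _ => ?_, fun t => ?_⟩
  · dsimp only
    by_cases e : H' = H
    · subst e
      rw [Function.update_self]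
      exact hx
    · rw [Function.update_of_ne e]
      exact @continuous_const _ _ _ (FixedBy.topology X H') _
  · refine (h t).trans ?_
    rw [pTotal_apply, Finset.sum_eq_single H]
    · simp only [FMod.mu, Fin.sum_univ_one, Function.update_self, Pi.single_eq_same]
      rfl
    · intro H' _ e
      simp [FMod.mu, Pi.single_eq_of_ne e]
    · simp

/-- A continuous formal sum lifts to `∏_H ∐ₖ (M(G/H) × X^H)ᵏ`, so that it is continuous. -/
theorem continuous [UCompactlyGeneratedSpace.{u} T] (hφ : IsContinuousSum M φ) :
    Continuous φ := by
  obtain ⟨k, l, x, hx, h⟩ := hφ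
  let _ : ∀ H : Subgroup G, TopologicalSpace (FixedBy X H) := FixedBy.topology X
  let _ : ∀ H : Subgroup G, TopologicalSpace (M.obj (OrbitCat.of H)) := fun _ => ⊥
  let τ : ∀ H : Subgroup G, TopologicalSpace (FMod R (FixedBy.pt X H) (M.obj (OrbitCat.of H))) :=
    fun H => FMod.topology R (FixedBy.topology X H) (FixedBy.pt X H) (M.obj (OrbitCat.of H))
  have h1 : ∀ H, Continuous fun t => FMod.mu R (FixedBy.pt X H) (M.obj (OrbitCat.of H)) (k H)
      fun i => (l H i, x H i t) := by
    intro H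
    let _ : ∀ k, TopologicalSpace (Fin k → M.obj (OrbitCat.of H) × FixedBy X H) :=
      FMod.powTopology (FixedBy X H) (FixedBy.topology X H) (M.obj (OrbitCat.of H))
    have h2 : Continuous fun t i => (l H i, x H i t) :=
      continuous_kTopology_rng (t := Pi.topologicalSpace)
        (continuous_pi fun i => continuous_const.prodMk (hx H i))
    let m : (Σ k, Fin k → M.obj (OrbitCat.of H) × FixedBy X H) →
        FMod R (FixedBy.pt X H) (M.obj (OrbitCat.of H)) := fun z => FMod.mu R _ _ z.1 z.2
    have h3 : Continuous m := continuous_coinduced_rng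
    exact h3.comp (continuous_sigmaMk.comp h2)
  have h4 := continuous_kTopology_rng (t := Pi.topologicalSpace) (continuous_pi h1)
  let _ : TopologicalSpace (∀ H, FMod R (FixedBy.pt X H) (M.obj (OrbitCat.of H))) :=
    kTopology.{u} Pi.topologicalSpace
  have h5 : Continuous (Y := EF M X) (pTotal M X) := continuous_coinduced_rng
  exact (h5.comp h4).congr fun t => (h t).symm

end IsContinuousSum

variable (M)

theorem continuous_assembly_F (Q : SimplicialPtGSet.{u} G) :
    Continuous (Y := EF M (realize Q)) (assembly (FFunctor M) Q) := by
  refine ModRealization.continuous_of_mk fun n a => IsContinuousSum.continuous ?_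
  change F M (Q.obj (op n)) at a
  induction a using PtFin.induction_on with
  | zero =>
    refine (congrArg (IsContinuousSum M) (funext fun t => ?_)).mpr IsContinuousSum.zero
    exact map_zero (F.map M (pointMap Q t))
  | gen x l =>
    let c : TopSimplex n → FixedBy (realize Q) (MulAction.stabilizer G x) := fun t =>
      ⟨pointOf x t, fun h hh => stabilizer_le_point x t hh⟩
    refine IsContinuousSum.single (x := c) ?_ l fun t => ?_
    · exact continuous_kTopology_rng
        (continuous_induced_rng.2 (Realization.continuous_mk (X := toSSet Q) x))
    · rw [pFixed_gen]
      exact assembly_F_gen M Q x l t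
  | add a b ha hb =>
    refine (congrArg (IsContinuousSum M) (funext fun t => ?_)).mpr (ha.add hb)
    exact map_add (F.map M (pointMap Q t)) a b

end Continuity

/-! ### Fixed points of the realization -/

section FixedPoints

variable {G : Type w} [Group G] (Q : SimplicialPtGSet.{u} G) (H : Subgroup G)

/-- The simplicial subset `Q^H` of the simplices of `Q` fixed under `H`. -/
def fixedSSet : SSet.{u} where
  obj n := {x : Q.obj n // ∀ h ∈ H, h • x = x}
  map α := ↾ fun x => ⟨(Q.map α).toFun x.1, fun h hh => by
    rw [← (Q.map α).map_smul, x.2 h hh]⟩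
  map_id n := ConcreteCategory.hom_ext _ _ fun x =>
    Subtype.ext (congrArg (fun f : Q.obj n ⟶ Q.obj n => f.toFun x.1) (Q.map_id n))
  map_comp {a b c} α β := ConcreteCategory.hom_ext _ _ fun x =>
    Subtype.ext (congrArg (fun f : Q.obj a ⟶ Q.obj c => f.toFun x.1) (Q.map_comp α β))

/-- The inclusion `Q^H → Q`. -/
def fixedSSetInclusion : fixedSSet Q H ⟶ toSSet Q where
  app _ := ↾ fun x => x.1
  naturality _ _ _ := rfl

variable {Q} in
/-- The canonical map `|Q^H| → |Q|^H`. -/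
noncomputable def realizationFixed (p : Realization (fixedSSet Q H)) : FixedBy (realize Q) H :=
  ⟨Realization.map (fixedSSetInclusion Q H) p, fun h hh => by
    induction p using Realization.ind with | _ n x t => ?_
    exact congrArg (fun y => point y t) (x.2 h hh)⟩

theorem realizationFixed_surjective : Function.Surjective (realizationFixed (Q := Q) H) := by
  rintro ⟨p, hp⟩
  obtain ⟨n, x, t, ht, rfl⟩ := Realization.exists_interior (X := toSSet Q) p
  exact ⟨Realization.mk (X := fixedSSet Q H) ⟨x, fun h hh => pointMap_injective Q ht (hp h hh)⟩ t,
    rfl⟩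

/-- `|Q|^H` is the realization of `Q^H`: a map that is continuous on `|Q^H|` is continuous
on `|Q|^H`. -/
theorem continuous_fixedBy_dom {Z : Type*} [TopologicalSpace Z] {f : FixedBy (realize Q) H → Z}
    (hf : Continuous fun p => f (realizationFixed H p)) :
    @Continuous _ _ (FixedBy.topology (realize Q) H) _ f := by
  refine continuous_kTopology_dom (t := (realize Q).top.induced Subtype.val) ?_
  let _ := (realize Q).top.induced (Subtype.val : FixedBy (realize Q) H → _)
  have h1 : Topology.IsClosedEmbedding (Realization.map (fixedSSetInclusion Q H)) :=
    Realization.isClosedEmbedding_map fun n => Subtype.val_injective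
  have h2 : Topology.IsInducing (Subtype.val : FixedBy (realize Q) H → (realize Q).carrier) :=
    ⟨rfl⟩
  have h3 : Topology.IsInducing (realizationFixed (Q := Q) H) :=
    (h2.of_comp_iff (f := realizationFixed (Q := Q) H)).1 h1.isInducing
  refine continuous_def.2 fun s hs => ?_
  obtain ⟨U, hU, e⟩ := h3.isOpen_iff.1 (hs.preimage hf)
  convert hU
  exact (realizationFixed_surjective Q H).preimage_injective e.symm

end FixedPoints

/-! ### Continuity of the inverse -/

section Inverse

variable {G : Type w} [Group G] {R : Type v} [CommRing R] (M : OrbitCat G ⥤ ModuleCat.{u} R)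
  (Q : SimplicialPtGSet.{u} G)

/-- The isomorphism of groups `Ψ_Q : |F(Q, M)| → 𝔉(|Q|, M)`. -/
noncomputable def psiAddEquiv : ModRealization (SF M Q) ≃+ EF M (realize Q) :=
  AddEquiv.ofBijective (show ModRealization (SF M Q) →+ EF M (realize Q) from
    assembly (FFunctor M) Q) (assembly_F_bijective M Q)

theorem psiAddEquiv_symm_pFixed {H : Subgroup G} {n : SimplexCategory} (x : Q.obj (op n))
    (hx : ∀ h ∈ H, h • x = x) (t : TopSimplex n) (l : M.obj (OrbitCat.of H)) :
    (psiAddEquiv M Q).symm (pFixed M (realize Q) H (PtFin.gen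
      (realizationFixed H (Realization.mk (X := fixedSSet Q H) ⟨x, hx⟩ t)) l)) =
    ModRealization.mk (SF.gen M x (M.map (OrbitCat.proj fun h hh => hx h hh) l)) t := by
  refine (AddEquiv.symm_apply_eq _).2 ((pFixed_gen M _ _ _ _).trans ?_)
  refine Eq.trans ?_ (assembly_F_gen M Q x _ t).symm
  exact congrArg (F.gen (pointOf x t)) (map_proj_map_proj M _ _ l).symm

variable [Finite G]

/-- The topology of `𝔉(|Q|, M)` is that of a quotient of a space of finite formal sums; since
`|F(Q, M)|` is a topological group in k-spaces, continuity has to be checked only on single terms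
`l x`, with `x ∈ |Q|^H`. -/
theorem continuous_psiAddEquiv_symm : Continuous (psiAddEquiv M Q).symm := by
  have hA := ModRealization.isKTopologicalAddGroup (SF M Q)
  let _ := Fintype.ofFinite (Subgroup G)
  let X := realize Q
  let _ : ∀ H : Subgroup G, TopologicalSpace (FixedBy X H) := FixedBy.topology X
  let _ : ∀ H : Subgroup G, TopologicalSpace (M.obj (OrbitCat.of H)) := fun _ => ⊥
  have : ∀ H : Subgroup G, DiscreteTopology (M.obj (OrbitCat.of H)) := fun _ => ⟨rfl⟩
  have h1 : ∀ H : Subgroup G, Continuous fun z : M.obj (OrbitCat.of H) × FixedBy X H =>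
      (psiAddEquiv M Q).symm (pFixed M X H (PtFin.gen z.2 z.1)) := by
    intro H
    refine continuous_prod_of_discrete_left.2 fun l => continuous_fixedBy_dom Q H ?_
    refine Realization.continuous_of_mk fun n x => ?_
    exact (ModRealization.continuous_mk (A := SF M Q) _).congr fun t =>
      (psiAddEquiv_symm_pFixed M Q x.1 x.2 t l).symm
  let τ : ∀ H : Subgroup G, TopologicalSpace (FMod R (FixedBy.pt X H) (M.obj (OrbitCat.of H))) :=
    fun H => FMod.topology R (FixedBy.topology X H) (FixedBy.pt X H) (M.obj (OrbitCat.of H))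
  have h2 : ∀ H : Subgroup G, Continuous fun z : FMod R (FixedBy.pt X H) (M.obj (OrbitCat.of H)) =>
      (psiAddEquiv M Q).symm (pFixed M X H z) := by
    intro H
    refine continuous_coinduced_dom.2 ?_
    let _ : ∀ k, TopologicalSpace (Fin k → M.obj (OrbitCat.of H) × FixedBy X H) :=
      FMod.powTopology (FixedBy X H) (FixedBy.topology X H) (M.obj (OrbitCat.of H))
    refine continuous_sigma fun k => ?_
    have : UCompactlyGeneratedSpace.{u} (Fin k → M.obj (OrbitCat.of H) × FixedBy X H) :=
      uCompactlyGeneratedSpace_kTopology _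
    refine (hA.sum Finset.univ (f := fun i z =>
      (psiAddEquiv M Q).symm (pFixed M X H (PtFin.gen (z i).2 (z i).1))) fun i => ?_).congr
        fun z => ?_
    · exact (h1 H).comp (continuous_kTopology_dom (t := Pi.topologicalSpace) (continuous_apply i))
    · exact ((congrArg _ (map_sum (pFixed M X H) _ _)).trans
        (map_sum (psiAddEquiv M Q).symm _ _)).symm
  refine continuous_coinduced_dom.2 ?_
  let _ : TopologicalSpace (∀ H, FMod R (FixedBy.pt X H) (M.obj (OrbitCat.of H))) :=
    kTopology.{u} Pi.topologicalSpace
  have : UCompactlyGeneratedSpace.{u} (∀ H, FMod R (FixedBy.pt X H) (M.obj (OrbitCat.of H))) :=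
    uCompactlyGeneratedSpace_kTopology _
  refine (hA.sum Finset.univ (f := fun H z =>
    (psiAddEquiv M Q).symm (pFixed M X H (z H))) fun H => ?_).congr fun z => ?_
  · exact (h2 H).comp (continuous_kTopology_dom (t := Pi.topologicalSpace) (continuous_apply H))
  · exact ((congrArg _ (pTotal_apply M X z)).trans (map_sum (psiAddEquiv M Q).symm _ _)).symm

end Inverse

/-! ### The three isomorphisms of topological groups -/

section Isomorphisms

variable {G : Type w} [Group G] [Finite G] {R : Type v} [CommRing R]
  (M : OrbitCat G ⥤ ModuleCat.{u} R) (Q : SimplicialPtGSet.{u} G)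

/-- The isomorphism `Ψ_Q : |F(Q, M)| → 𝔉(|Q|, M)`. -/
noncomputable def psi : ModRealization (SF M Q) ≃ₜ+ EF M (realize Q) where
  __ := psiAddEquiv M Q
  continuous_toFun := continuous_assembly_F M Q
  continuous_invFun := continuous_psiAddEquiv_symm M Q

theorem iota_assembly_FBar (p : ModRealization (SFBar M Q)) :
    EF.iota M (realize Q) (assembly (FBarFunctor M) Q p) =
      psi M Q (ModRealization.map (SF.iota M Q) p) :=
  (assembly_natTrans (iotaNat M) p).symm

theorem assembly_FQuot_beta (p : ModRealization (SF M Q)) :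
    assembly (FQuotFunctor M) Q (ModRealization.map (SF.beta M Q) p) =
      EF.beta M (realize Q) (psi M Q p) :=
  assembly_natTrans (betaNat M) p

/-- The isomorphism `Ψ̄ᴳ_Q : |F̄ᴳ(Q, M)| → 𝔉̄ᴳ(|Q|, M)`. Both groups carry the k-topology induced
from the corresponding groups without invariants: on the left this is because `|ι_Q|` is a closed
embedding. -/
noncomputable def psiBar : ModRealization (SFBar M Q) ≃ₜ+ EFBar M (realize Q) where
  __ := AddEquiv.ofBijective (show ModRealization (SFBar M Q) →+ EFBar M (realize Q) from
    assembly (FBarFunctor M) Q) (assembly_FBar_bijective M Q)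
  continuous_toFun := by
    have := (ModRealization.isKTopologicalAddGroup (SFBar M Q)).kspace
    refine continuous_kTopology_rng (continuous_induced_rng.2 ?_)
    exact ((psi M Q).continuous.comp (ModRealization.continuous_map (SF.iota M Q))).congr
      fun p => (iota_assembly_FBar M Q p).symm
  continuous_invFun := by
    have hι : Continuous (EF.iota M (realize Q)) :=
      continuous_kTopology_dom (t := (EF.topology M (realize Q)).induced (EF.iota M (realize Q)))
        continuous_induced_dom
    refine (ModRealization.isClosedEmbedding_map (f := SF.iota M Q)
      fun n => Subtype.val_injective).isInducing.continuous_iff.2 ?_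
    refine ((psi M Q).symm.continuous.comp hι).congr fun v => ?_
    obtain ⟨p, rfl⟩ := (assembly_FBar_bijective M Q).2 v
    refine ((psi M Q).symm_apply_eq.2 (iota_assembly_FBar M Q p)).trans ?_
    exact congrArg _
      ((AddEquiv.ofBijective _ (assembly_FBar_bijective M Q)).symm_apply_apply p).symm

/-- The isomorphism `Ψᴳ_Q : |Fᴳ(Q, M)| → 𝔉ᴳ(|Q|, M)`. Both groups are quotients, by `|β_Q|` and by
`β_{|Q|}`. -/
noncomputable def psiQuot : ModRealization (SFQuot M Q) ≃ₜ+ EFQuot M (realize Q) where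
  __ := AddEquiv.ofBijective (show ModRealization (SFQuot M Q) →+ EFQuot M (realize Q) from
    assembly (FQuotFunctor M) Q) (assembly_FQuot_bijective M Q)
  continuous_toFun := by
    have hβ : Continuous (EF.beta M (realize Q)) := continuous_coinduced_rng
    refine ModRealization.continuous_of_mk fun n a => ?_
    obtain ⟨b, rfl⟩ := F.beta_surjective M (Q.obj (op n)) a
    exact (hβ.comp ((psi M Q).continuous.comp (ModRealization.continuous_mk (A := SF M Q) b))).congr
      fun t => (assembly_FQuot_beta M Q (ModRealization.mk (A := SF M Q) b t)).symm
  continuous_invFun := by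
    refine continuous_coinduced_dom.2 ?_
    refine ((ModRealization.continuous_map (SF.beta M Q)).comp (psi M Q).symm.continuous).congr
      fun v => ?_
    obtain ⟨p, rfl⟩ := (psi M Q).surjective v
    refine (congrArg _ ((psi M Q).symm_apply_apply p)).trans ?_
    refine ((AddEquiv.ofBijective _ (assembly_FQuot_bijective M Q)).symm_apply_eq.2 ?_).symm
    exact (assembly_FQuot_beta M Q p).symm

end Isomorphisms

end DoldThom

theorem theorem2p10 {G : Type w} [Group G] [Finite G] {R : Type v} [CommRing R]
    (M : OrbitCat G ⥤ ModuleCat.{u} R) :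
    ∃ (Ψ : ∀ Q : SimplicialPtGSet.{u} G, ModRealization (SF M Q) ≃ₜ+ EF M (realize Q))
      (ΨBar : ∀ Q : SimplicialPtGSet.{u} G, ModRealization (SFBar M Q) ≃ₜ+ EFBar M (realize Q))
      (ΨQuot : ∀ Q : SimplicialPtGSet.{u} G,
        ModRealization (SFQuot M Q) ≃ₜ+ EFQuot M (realize Q)),
      -- the groups are topological groups in the category of k-spaces
      (∀ Q : SimplicialPtGSet.{u} G,
        IsKTopologicalAddGroup (ModRealization (SF M Q)) ∧
        IsKTopologicalAddGroup (EF M (realize Q)) ∧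
        IsKTopologicalAddGroup (ModRealization (SFBar M Q)) ∧
        IsKTopologicalAddGroup (EFBar M (realize Q)) ∧
        IsKTopologicalAddGroup (ModRealization (SFQuot M Q)) ∧
        IsKTopologicalAddGroup (EFQuot M (realize Q))) ∧
      -- `Ψ_Q([l x, t]) = M_*(q_{x,t})(l) [x, t]`
      (∀ (Q : SimplicialPtGSet.{u} G) (n : SimplexCategory) (x : Q.obj (op n)) (l : coeffAt M x)
        (t : TopSimplex n), Ψ Q (ModRealization.mk (SF.gen M x l) t) =
          EF.gen M (pointOf x t) (M.map (OrbitCat.proj (stabilizer_le_point x t)) l)) ∧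
      -- compatibility with the inclusions `ι` and with the epimorphisms `β`
      (∀ (Q : SimplicialPtGSet.{u} G) (p : ModRealization (SFBar M Q)),
        EF.iota M (realize Q) (ΨBar Q p) = Ψ Q (ModRealization.map (SF.iota M Q) p)) ∧
      (∀ (Q : SimplicialPtGSet.{u} G) (p : ModRealization (SF M Q)),
        ΨQuot Q (ModRealization.map (SF.beta M Q) p) = EF.beta M (realize Q) (Ψ Q p)) ∧
      -- naturality
      (∀ (Q Q' : SimplicialPtGSet.{u} G) (f : Q ⟶ Q'),
        (∀ p : ModRealization (SF M Q),
          Ψ Q' (ModRealization.map (Functor.whiskerRight f (FFunctor M)) p) =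
            EF.map M (realizeMap f) (Ψ Q p)) ∧
        (∀ p : ModRealization (SFBar M Q),
          ΨBar Q' (ModRealization.map (Functor.whiskerRight f (FBarFunctor M)) p) =
            EFBar.map M (realizeMap f) (ΨBar Q p)) ∧
        (∀ p : ModRealization (SFQuot M Q),
          ΨQuot Q' (ModRealization.map (Functor.whiskerRight f (FQuotFunctor M)) p) =
            EFQuot.map M (realizeMap f) (ΨQuot Q p))) := by

  refine ⟨psi M, psiBar M, psiQuot M, fun Q => ?_, fun Q _ x l t => assembly_F_gen M Q x l t,
    iota_assembly_FBar M, assembly_FQuot_beta M, fun Q Q' f =>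
      ⟨assembly_map (Φ := FFunctor M) f, assembly_map (Φ := FBarFunctor M) f,
        assembly_map (Φ := FQuotFunctor M) f⟩⟩
  have h := ModRealization.isKTopologicalAddGroup (SF M Q)
  have hBar := ModRealization.isKTopologicalAddGroup (SFBar M Q)
  have hQuot := ModRealization.isKTopologicalAddGroup (SFQuot M Q)
  exact ⟨h, h.of_equiv (psi M Q), hBar, hBar.of_equiv (psiBar M Q), hQuot,
    hQuot.of_equiv (psiQuot M Q)⟩
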